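/- **Setting.** Let $\Omega\in\mathbb R^{p\times p}$ be positive definite and let $X\in\mathbb R^{n\times p}$ have i.i.d. rows from $\mathcal N_p(0,\Omega^{-1})$, with $n\ge 4p$. Let $G=([p],E)$ be the associated undirected graph: $(i,j)\in E$ iff $i\ne j$ and the coordinates $i$ and $j$ are conditionally dependent given all other coordinates. Edges are undirected: $(i,j)$ and $(j,i)$ count once. Let $q\in[0,1]$ and $\delta\in\{0,1\}$. Write $X^{(i)}$ for the $i$-th column of $X$ and $X^{(-i)}$ for $X$ without its $i$-th column. **Knockoffs.** For a design $D$ of full column rank with at least twice as many rows as columns, a strategy $\mathcal O\in\{\mathcal O_{\rm equi},\mathcal O_{\rm sdp}\}$ yields $\widetilde D=D\,(I-(D^TD)^{-1}\mathrm{diag}\{s\})+\widetilde U C$, where $\widetilde U$ has orthonormal columns orthogonal to those of $D$ and $C^TC=2\,\mathrm{diag}\{s\}-\mathrm{diag}\{s\}(D^TD)^{-1}\mathrm{diag}\{s\}$. For $\mathcal O_{\rm equi}$, $s_j=\min(2\lambda_{\min}(D^TD),1)$ for all $j$; for $\mathcal O_{\rm sdp}$, $s$ minimizes $\sum_j(1-s_j)$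 subject to $\mathrm{diag}\{s\}\preceq 2D^TD$ and $0\le s_j\le 1$. The construction is applied either to the design as it is or to the design with columns rescaled to unit length (the knockoffs being scaled back). The choices of $s,\widetilde U,C$ depend measurably on $D$ only. **Feature statistics.** A procedure $\mathcal P$ maps a full-column-rank design $D$, a knockoff matrix $\widetilde D$ of $D$ (that is, $\widetilde D^T\widetilde D=D^TD$ and $D^T\widetilde D=D^TD-\mathrm{diag}\{s\}$ for some $s\ge 0$) and a response $y$ to a vector of statistics. It is assumed to satisfy sufficiency (the vector is a measurable function of $[D\ \widetilde D]^T[D\ \widetilde D]$ and $[D\ \widetilde D]^Ty$) and antisymmetry (swapping the columns of some variables with those of their knockoffs changes the sign of exactly the statistics of these variables). With the design $X^{(-i)}$ and the response $X^{(i)}$ for each $i$, this gives $W=(W^{(i)}_j)_{i,j\in[p]}$, with $W^{(i)}_i=0$. **Thresholds and edges.** For a threshold vector $T\in(0,\infty]^p$ let $\widehat V_i^{+}(T_i)=\{j:W_j^{(i)}\ge T_i\}$ and $\widehat V_i^-(T_i)=\{j:W_j^{(i)}\le -T_i\}$. With a rule $\mathcal R\in\{\mathcal R_{\rm AND},\mathcal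 R_{\rm OR}\}$, $\widehat E(T)$ consists of the pairs $i\neq j$ with $i\in\widehat V_j^+(T_j)$ and (AND), respectively or (OR), $j\in\widehat V_i^+(T_i)$. For a pair $(a,c_a)$, $T$ is feasible if for all $i$ $$\frac{a\delta+|\widehat V_i^-(T_i)|}{|\widehat E(T)|\vee 1}\le \kappa,\qquad T_i\in\big(\{|W^{(i)}_j|:j\in[p]\}\cup\{+\infty\}\big)\setminus\{0\},$$ with $\kappa=2q/(c_ap)$ for AND and $\kappa=q/(c_ap)$ for OR. Let $m_{\max}=\lfloor q(p-1)/c_a-a\delta\rfloor$ for AND and $m_{\max}=\lfloor q(p-1)/(2c_a)-a\delta\rfloor$ for OR. The threshold vector $\widehat T$ is the first feasible vector among those obtained for $m=m_{\max},m_{\max}-1,\dots,0$ by taking, for each $i$, the least admissible $T_i$ with $|\widehat V_i^-(T_i)|\le m$; if there is none (in particular if $m_{\max}<0$), $\widehat T=(+\infty,\dots,+\infty)$. The estimated edge set is $\widehat E=\widehat E(\widehat T)$. The *GGM knockoff filter* applied to a data matrix with hyperparameters $((a,c_a),\mathcal O,\mathcal P,\mathcal R)$ computes $W$ with the knockoffs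 $\widetilde X^{(-i)}$ constructed from $X^{(-i)}$ by $\mathcal O$, and then $\widehat E$. **Sample-splitting-recycling.** Let $\boldsymbol A\subseteq\{(1,1.93),(0.01,102)\}$, $\boldsymbol{\mathcal O}\subseteq\{\mathcal O_{\rm equi},\mathcal O_{\rm sdp}\}$ and $\boldsymbol{\mathcal R}\subseteq\{\mathcal R_{\rm AND},\mathcal R_{\rm OR}\}$ be non-empty, and let $\boldsymbol{\mathcal P}$ be a non-empty finite set of procedures as above. 1. Split the rows of $X$ at random, independently of $X$, into $X_1$ with $\lfloor n/2\rfloor$ rows and $X_2$ with the remaining rows. 2. Run the GGM knockoff filter on $X_1$ (with the given $q,\delta$) for all combinations in $\boldsymbol A\times\boldsymbol{\mathcal O}\times\boldsymbol{\mathcal P}\times\boldsymbol{\mathcal R}$, and choose a combination $((a,c_a),\mathcal O,\mathcal P,\mathcal R)$ with the largest number of discoveries; ties may be broken at random, independently of $X$. 3. Compute $W$ by $\mathcal P$ from all samples $X^{\rm re}=\binom{X_1}{X_2}$ with the recycled knockoffs $\binom{X_1^{(-i)}}{\widetilde X_2^{(-i)}}$, where $\widetilde X_2^{(-i)}$ is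 constructed from $X_2^{(-i)}$ by $\mathcal O$. 4. Compute $\widehat E$ from this $W$ with $q,\delta,(a,c_a),\mathcal R$ as above, and let $\widehat F=\widehat E\setminus E$. **Theorem.** With $\delta=1$ the procedure satisfies $$\mathrm{FDR}=\mathbb E\left[\frac{|\widehat F|}{|\widehat E|\vee 1}\right]\le q,$$ and with $\delta=0$ it satisfies $$\mathrm{mFDR}^{\rm re}=\mathbb E\left[\frac{|\widehat F|}{|\widehat E|+a c_a p/\big(q\,\mathbb 1_{\{\mathcal R_{\rm AND}\text{ is chosen}\}}+q\big)}\right]\le q,$$ where for $q=0$ the term $a c_a p/0$ is read as $+\infty$ (so that $\mathrm{mFDR}^{\rm re}=0$). -/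

import Mathlib

open MeasureTheory ProbabilityTheory
open scoped ENNReal

namespace GGMKnockoff

/-- Matrices over a measurable space carry the entrywise (product) sigma-algebra. -/
instance instMeasurableSpaceMatrix {m n : Type*} : MeasurableSpace (Matrix m n ℝ) :=
  inferInstanceAs (MeasurableSpace (m → n → ℝ))

/-- The nodes other than `i`: the predictors in the node-wise regression with response `i`. -/
abbrev Others {p : ℕ} (i : Fin p) : Type := {j : Fin p // j ≠ i}

/-! ### The Gaussian graphical model -/

/-- `(i, j)` is an edge of the graph of the centred Gaussian vector with precision matrix `Om`:
`i ≠ j`, and the coordinates `i` and `j` are conditionally dependent given all the others. -/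
def IsEdge {p : ℕ} (Om : Matrix (Fin p) (Fin p) ℝ) (i j : Fin p) : Prop :=
  i ≠ j ∧
    ¬ CondIndepFun
        (MeasurableSpace.comap
          (fun (x : EuclideanSpace ℝ (Fin p)) (k : {k : Fin p // k ≠ i ∧ k ≠ j}) => x k.1)
          inferInstance)
        (Measurable.comap_le (by fun_prop))
        (fun x : EuclideanSpace ℝ (Fin p) => x i)
        (fun x : EuclideanSpace ℝ (Fin p) => x j)
        (multivariateGaussian 0 Om⁻¹)

/-- The rows of `X` are i.i.d. observations from the centred Gaussian distribution with
precision matrix `Om`. -/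
structure IsGaussianSample {Ω : Type*} [MeasurableSpace Ω] (μ : Measure Ω) {n p : ℕ}
    (Om : Matrix (Fin p) (Fin p) ℝ) (X : Ω → Matrix (Fin n) (Fin p) ℝ) : Prop where
  measurable : Measurable X
  indep : iIndepFun (fun (k : Fin n) (ω : Ω) => X ω k) μ
  law : ∀ k : Fin n,
    μ.map (fun ω => WithLp.toLp 2 (X ω k)) = multivariateGaussian 0 Om⁻¹

/-! ### Fixed-X knockoffs -/

section Knockoffs

variable {m ι : Type*} [Fintype m] [Fintype ι] [DecidableEq ι]

/-- `Xt` is a knockoff matrix of `X`: same Gram matrix, and the cross products agree with the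
Gram matrix up to a non-negative diagonal matrix. -/
def IsKnockoff (X Xt : Matrix m ι ℝ) : Prop :=
  ∃ s : ι → ℝ, (∀ j, 0 ≤ s j) ∧
    X.transpose * Xt = X.transpose * X - Matrix.diagonal s ∧
    Xt.transpose * X = X.transpose * X - Matrix.diagonal s ∧
    Xt.transpose * Xt = X.transpose * X

/-- The strategies for computing the vector `s`. -/
inductive OptStrategy : Type
  | equi
  | sdp

/-- Feasible points of the semidefinite program with Gram matrix `G`. -/
def SDPFeasible (G : Matrix ι ι ℝ) (s : ι → ℝ) : Prop :=
  ((2 : ℝ) • G - Matrix.diagonal s).PosSemidef ∧ ∀ j, 0 ≤ s j ∧ s j ≤ 1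

/-- `s` is produced by the given strategy from the Gram matrix `G`. For `equi`, the minimal
eigenvalue of the symmetric matrix `G` is the least element of its (finite) spectrum. -/
def IsStrategySolution (o : OptStrategy) (G : Matrix ι ι ℝ) (s : ι → ℝ) : Prop :=
  match o with
  | .equi => ∀ j, s j = min (2 * sInf (spectrum ℝ G)) 1
  | .sdp => SDPFeasible G s ∧
      ∀ s', SDPFeasible G s' → ∑ j, (1 - s j) ≤ ∑ j, (1 - s' j)

/-- `Xt = X (I - (XᵀX)⁻¹ diag s) + U C`, where `s` comes from the strategy `o`, the columns of `U`
are orthonormal and orthogonal to those of `X`, and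
`CᵀC = 2 diag s - diag s (XᵀX)⁻¹ diag s`. -/
def IsConstructedKnockoff (o : OptStrategy) (X Xt : Matrix m ι ℝ) : Prop :=
  ∃ (s : ι → ℝ) (U : Matrix m ι ℝ) (C : Matrix ι ι ℝ),
    IsStrategySolution o (X.transpose * X) s ∧
    U.transpose * U = 1 ∧
    U.transpose * X = 0 ∧
    C.transpose * C = (2 : ℝ) • Matrix.diagonal s -
      Matrix.diagonal s * (X.transpose * X)⁻¹ * Matrix.diagonal s ∧
    Xt = X * (1 - (X.transpose * X)⁻¹ * Matrix.diagonal s) + U * C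

/-- Euclidean lengths of the columns. -/
noncomputable def colNorm (X : Matrix m ι ℝ) (j : ι) : ℝ := √(∑ k, X k j ^ 2)

/-- Divide column `j` by `d j`. -/
noncomputable def scaleCols (d : ι → ℝ) (X : Matrix m ι ℝ) : Matrix m ι ℝ :=
  Matrix.of fun k j => X k j / d j

/-- Exchange the columns in `H`: `[X Xt]_swap(H)` is `[swapCols H X Xt, swapCols H Xt X]`. -/
def swapCols (H : Finset ι) (X Xt : Matrix m ι ℝ) : Matrix m ι ℝ :=
  Matrix.of fun k j => if j ∈ H then Xt k j else X k j

end Knockoffs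

/-- A knockoff construction: for every sample size and response node, a map from designs to
knockoff matrices. -/
abbrev KnockoffRule (p : ℕ) : Type :=
  (n : ℕ) → (i : Fin p) → Matrix (Fin n) (Others i) ℝ → Matrix (Fin n) (Others i) ℝ

/-- `K` constructs knockoffs by the strategy `o`, for all designs of full column rank with at
least twice as many rows as columns. If `std` is true, the construction is carried out on the
design with columns rescaled to unit length (and the knockoffs are scaled back); if it is false,
it is carried out on the design as it is. -/
structure IsKnockoffRule {p : ℕ} (std : Bool) (o : OptStrategy) (K : KnockoffRule p) : Prop where
  measurable : ∀ n i, Measurable (K n i)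
  constructed : ∀ (n : ℕ) (i : Fin p) (X : Matrix (Fin n) (Others i) ℝ),
    2 * Fintype.card (Others i) ≤ n → IsUnit (X.transpose * X).det →
    match std with
    | true => IsConstructedKnockoff o (scaleCols (colNorm X) X) (scaleCols (colNorm X) (K n i X))
    | false => IsConstructedKnockoff o X (K n i X)

/-! ### Feature statistics -/

/-- A procedure for the feature statistics: for every sample size and response node, a map from
design, knockoff matrix and response vector to the vector of statistics. -/
abbrev FeatureProcedure (p : ℕ) : Type :=
  (n : ℕ) → (i : Fin p) → Matrix (Fin n) (Others i) ℝ → Matrix (Fin n) (Others i) ℝ →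
    (Fin n → ℝ) → Others i → ℝ

/-- Sufficiency: the statistics are a (measurable) function of `[X Xt]ᵀ[X Xt]` and `[X Xt]ᵀ y`. -/
def HasSufficiency {p : ℕ} (P : FeatureProcedure p) : Prop :=
  ∀ (n : ℕ) (i : Fin p),
    ∃ f : Matrix (Others i ⊕ Others i) (Others i ⊕ Others i) ℝ × (Others i ⊕ Others i → ℝ) →
        Others i → ℝ,
      Measurable f ∧
      ∀ (X Xt : Matrix (Fin n) (Others i) ℝ) (y : Fin n → ℝ),
        IsUnit (X.transpose * X).det → IsKnockoff X Xt →
        P n i X Xt y =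
          f ((Matrix.fromCols X Xt).transpose * Matrix.fromCols X Xt,
            (Matrix.fromCols X Xt).transpose.mulVec y)

/-- Antisymmetry: exchanging original variables with their knockoffs switches the signs of
exactly the corresponding statistics. -/
def HasAntisymmetry {p : ℕ} (P : FeatureProcedure p) : Prop :=
  ∀ (n : ℕ) (i : Fin p) (X Xt : Matrix (Fin n) (Others i) ℝ) (y : Fin n → ℝ),
    IsUnit (X.transpose * X).det → IsKnockoff X Xt →
    ∀ (H : Finset (Others i)) (j : Others i),
      P n i (swapCols H X Xt) (swapCols H Xt X) y j =
        if j ∈ H then - P n i X Xt y j else P n i X Xt y j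

/-- The design matrix of the regression on node `i`: delete column `i`. -/
def nodeDesign {n p : ℕ} (X : Matrix (Fin n) (Fin p) ℝ) (i : Fin p) :
    Matrix (Fin n) (Others i) ℝ :=
  X.submatrix id Subtype.val

/-- The feature statistic matrix for data `X` and node-wise knockoffs `Xt`. Here `W i j` is the
statistic of predictor `j` when node `i` is the response, with `W i i = 0`. -/
def statMatrix {n p : ℕ} (P : FeatureProcedure p) (X : Matrix (Fin n) (Fin p) ℝ)
    (Xt : (i : Fin p) → Matrix (Fin n) (Others i) ℝ) : Fin p → Fin p → ℝ :=
  fun i j => if h : j ≠ i then P n i (nodeDesign X i) (Xt i) (fun k => X k i) ⟨j, h⟩ else 0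

/-! ### Thresholds and edge sets -/

/-- The rules for combining estimated neighbourhoods into a graph. -/
inductive EdgeRule : Type
  | AND
  | OR

open Classical in
/-- `{j : W i j ≥ T i}`, the estimated neighbourhood of `i`. -/
noncomputable def posSet {p : ℕ} (W : Fin p → Fin p → ℝ) (i : Fin p) (t : EReal) :
    Finset (Fin p) :=
  Finset.univ.filter fun j => t ≤ (W i j : EReal)

open Classical in
/-- `{j : W i j ≤ -T i}`. -/
noncomputable def negSet {p : ℕ} (W : Fin p → Fin p → ℝ) (i : Fin p) (t : EReal) :
    Finset (Fin p) :=
  Finset.univ.filter fun j => (W i j : EReal) ≤ -t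

open Classical in
/-- The edge set obtained from neighbourhoods `V`; an undirected edge is the pair `(i, j)` with
`i < j`, so it is counted once. -/
noncomputable def edgesOf {p : ℕ} (r : EdgeRule) (V : Fin p → Finset (Fin p)) :
    Finset (Fin p × Fin p) :=
  Finset.univ.filter fun e => e.1 < e.2 ∧
    match r with
    | .AND => e.1 ∈ V e.2 ∧ e.2 ∈ V e.1
    | .OR => e.1 ∈ V e.2 ∨ e.2 ∈ V e.1

/-- The estimated edge set for statistics `W` and thresholds `T`. -/
noncomputable def estEdges {p : ℕ} (r : EdgeRule) (W : Fin p → Fin p → ℝ) (T : Fin p → EReal) :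
    Finset (Fin p × Fin p) :=
  edgesOf r fun i => posSet W i (T i)

/-- Admissible thresholds for node `i`: `({|W i j| : j} ∪ {+∞}) \ {0}`. -/
noncomputable def thresholdCandidates {p : ℕ} (W : Fin p → Fin p → ℝ) (i : Fin p) :
    Finset EReal :=
  (insert ⊤ (Finset.univ.image fun j => ((|W i j| : ℝ) : EReal))).erase 0

/-- The right-hand side of the constraints. -/
noncomputable def constraintLevel (p : ℕ) (r : EdgeRule) (q c : ℝ) : ℝ :=
  match r with
  | .AND => 2 * q / (c * p)
  | .OR => q / (c * p)

/-- The constraints of the optimization problem (`δ = 1` for FDR, `δ = 0` for modified FDR);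
`ac` is the pair `(a, c_a)`. -/
def IsFeasible {p : ℕ} (r : EdgeRule) (q δ : ℝ) (ac : ℝ × ℝ) (W : Fin p → Fin p → ℝ)
    (T : Fin p → EReal) : Prop :=
  ∀ i, (ac.1 * δ + ((negSet W i (T i)).card : ℝ)) / max ((estEdges r W T).card : ℝ) 1
      ≤ constraintLevel p r q ac.2 ∧
    T i ∈ thresholdCandidates W i

open Classical in
/-- For every `i`, the least admissible threshold with `|negSet| ≤ k`. -/
noncomputable def levelThreshold {p : ℕ} (W : Fin p → Fin p → ℝ) (k : ℕ) : Fin p → EReal :=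
  fun i => ((thresholdCandidates W i).filter fun t => (negSet W i t).card ≤ k).inf id

/-- The bound from which the search starts. -/
noncomputable def searchBound (p : ℕ) (r : EdgeRule) (q δ : ℝ) (ac : ℝ × ℝ) : ℤ :=
  match r with
  | .AND => ⌊q * ((p : ℝ) - 1) / ac.2 - ac.1 * δ⌋
  | .OR => ⌊q * ((p : ℝ) - 1) / (2 * ac.2) - ac.1 * δ⌋

open Classical in
/-- The first feasible `levelThreshold` for `k, k - 1, …, 0`, and `+∞` if there is none. -/
noncomputable def searchDown {p : ℕ} (r : EdgeRule) (q δ : ℝ) (ac : ℝ × ℝ)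
    (W : Fin p → Fin p → ℝ) : ℕ → Fin p → EReal
  | 0 => if IsFeasible r q δ ac W (levelThreshold W 0) then levelThreshold W 0 else fun _ => ⊤
  | k + 1 => if IsFeasible r q δ ac W (levelThreshold W (k + 1)) then levelThreshold W (k + 1)
      else searchDown r q δ ac W k

/-- The threshold vector. -/
noncomputable def threshold {p : ℕ} (r : EdgeRule) (q δ : ℝ) (ac : ℝ × ℝ)
    (W : Fin p → Fin p → ℝ) : Fin p → EReal :=
  if searchBound p r q δ ac < 0 then fun _ => ⊤
  else searchDown r q δ ac W (searchBound p r q δ ac).toNat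

/-! ### The filter, and the filter with sample-splitting-recycling -/

/-- The hyperparameters `((a, c_a), O, P, R)`. -/
structure Hyper (p : ℕ) : Type where
  ac : ℝ × ℝ
  opt : OptStrategy
  proc : FeatureProcedure p
  rule : EdgeRule

/-- The edge set of the GGM knockoff filter on data `X`. -/
noncomputable def ggmFilter {n p : ℕ} (K : OptStrategy → KnockoffRule p) (q δ : ℝ) (h : Hyper p)
    (X : Matrix (Fin n) (Fin p) ℝ) : Finset (Fin p × Fin p) :=
  let W := statMatrix h.proc X fun i => K h.opt n i (nodeDesign X i)
  estEdges h.rule W (threshold h.rule q δ h.ac W)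

/-- The first `⌊n / 2⌋` rows. -/
def firstHalf {n p : ℕ} (X : Matrix (Fin n) (Fin p) ℝ) : Matrix (Fin (n / 2)) (Fin p) ℝ :=
  Matrix.of fun k => X ⟨k, by omega⟩

/-- The remaining `n - ⌊n / 2⌋` rows. -/
def secondHalf {n p : ℕ} (X : Matrix (Fin n) (Fin p) ℝ) : Matrix (Fin (n - n / 2)) (Fin p) ℝ :=
  Matrix.of fun k => X ⟨n / 2 + k, by omega⟩

/-- Recycled knockoffs: the first-half rows are copies of the design, the second-half rows are
the knockoffs constructed from the second half. -/
def recycledKnockoff {n p : ℕ} (K : KnockoffRule p) (X : Matrix (Fin n) (Fin p) ℝ) (i : Fin p) :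
    Matrix (Fin n) (Others i) ℝ :=
  Matrix.of fun k j =>
    if hk : (k : ℕ) < n / 2 then nodeDesign X i k j
    else K (n - n / 2) i (nodeDesign (secondHalf X) i) ⟨k - n / 2, by omega⟩ j

/-- The edge set computed from all samples with recycled knockoffs and hyperparameters `h`;
`X` is the data matrix after splitting, the first part being on top. -/
noncomputable def recycledFilter {n p : ℕ} (K : OptStrategy → KnockoffRule p) (q δ : ℝ)
    (h : Hyper p) (X : Matrix (Fin n) (Fin p) ℝ) : Finset (Fin p × Fin p) :=
  let W := statMatrix h.proc X fun i => recycledKnockoff (K h.opt) X i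
  estEdges h.rule W (threshold h.rule q δ h.ac W)

/-- All combinations of candidate hyperparameters. -/
def candidates {p : ℕ} (A : Set (ℝ × ℝ)) (Os : Set OptStrategy) (Ps : Set (FeatureProcedure p))
    (Rs : Set EdgeRule) : Set (Hyper p) :=
  {h | h.ac ∈ A ∧ h.opt ∈ Os ∧ h.proc ∈ Ps ∧ h.rule ∈ Rs}

/-- `sel` chooses, from the first half of the data, a candidate with the maximum number of
discoveries; ties are broken with the help of the auxiliary randomness in `S`. -/
structure IsSelection {S : Type*} [MeasurableSpace S] {n₁ p : ℕ} (H : Set (Hyper p))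
    (K : OptStrategy → KnockoffRule p) (q δ : ℝ)
    (sel : S → Matrix (Fin n₁) (Fin p) ℝ → Hyper p) : Prop where
  measurable : ∀ h, MeasurableSet {z : S × Matrix (Fin n₁) (Fin p) ℝ | sel z.1 z.2 = h}
  mem : ∀ u X₁, sel u X₁ ∈ H
  maximal : ∀ u X₁, ∀ h ∈ H, (ggmFilter K q δ h X₁).card ≤ (ggmFilter K q δ (sel u X₁) X₁).card

/-- The data after a random split: the rows are rearranged by the permutation `split u`. -/
def splitData {S : Type*} {n p : ℕ} (split : S → Equiv.Perm (Fin n)) (u : S)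
    (X : Matrix (Fin n) (Fin p) ℝ) : Matrix (Fin n) (Fin p) ℝ :=
  X.submatrix (split u) id

/-- The hyperparameters chosen by the procedure with sample-splitting-recycling. -/
def chosenHyper {S : Type*} {n p : ℕ} (split : S → Equiv.Perm (Fin n))
    (sel : S → Matrix (Fin (n / 2)) (Fin p) ℝ → Hyper p) (u : S)
    (X : Matrix (Fin n) (Fin p) ℝ) : Hyper p :=
  sel u (firstHalf (splitData split u X))

/-- The output of the GGM knockoff filter with sample-splitting-recycling. -/
noncomputable def recyclingProcedure {S : Type*} {n p : ℕ} (K : OptStrategy → KnockoffRule p)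
    (q δ : ℝ) (split : S → Equiv.Perm (Fin n))
    (sel : S → Matrix (Fin (n / 2)) (Fin p) ℝ → Hyper p) (u : S)
    (X : Matrix (Fin n) (Fin p) ℝ) : Finset (Fin p × Fin p) :=
  recycledFilter K q δ (chosenHyper split sel u X) (splitData split u X)

/-! ### Error rates -/

open Classical in
/-- The falsely discovered edges. -/
noncomputable def falseEdges {p : ℕ} (Om : Matrix (Fin p) (Fin p) ℝ)
    (E : Finset (Fin p × Fin p)) : Finset (Fin p × Fin p) :=
  E.filter fun e => ¬ IsEdge Om e.1 e.2

/-- The false discovery rate of a random edge set. -/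
noncomputable def FDR {Ω : Type*} [MeasurableSpace Ω] (μ : Measure Ω) {p : ℕ}
    (Om : Matrix (Fin p) (Fin p) ℝ) (E : Ω → Finset (Fin p × Fin p)) : ℝ≥0∞ :=
  ∫⁻ ω, ((falseEdges Om (E ω)).card : ℝ≥0∞) / max ((E ω).card : ℝ≥0∞) 1 ∂μ

/-- `a c_a p / (q 1_{R = AND} + q)`, with value `+∞` when `q = 0`. -/
noncomputable def mFDROffset {p : ℕ} (q : ℝ) (h : Hyper p) : ℝ≥0∞ :=
  ENNReal.ofReal (h.ac.1 * h.ac.2 * p) /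
    ENNReal.ofReal (q * (match h.rule with | .AND => 1 | .OR => 0) + q)

/-- The rule-dependent modified false discovery rate; `h` are the chosen hyperparameters. -/
noncomputable def mFDRre {Ω : Type*} [MeasurableSpace Ω] (μ : Measure Ω) {p : ℕ}
    (Om : Matrix (Fin p) (Fin p) ℝ) (q : ℝ) (h : Ω → Hyper p)
    (E : Ω → Finset (Fin p × Fin p)) : ℝ≥0∞ :=
  ∫⁻ ω, ((falseEdges Om (E ω)).card : ℝ≥0∞) / (((E ω).card : ℝ≥0∞) + mFDROffset q (h ω)) ∂μ

end GGMKnockoff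

/-!
Condition on the first half of the data and, in the second half, on the design of a node. If the
regression coefficient of a predictor is zero, reflecting the response in the hyperplane orthogonal
to the difference of the predictor and its knockoff has the same effect on the sufficient statistics
as exchanging the two columns, so it changes the sign of exactly one statistic; it preserves the
Gaussian noise, and in the recycled first half the two columns agree. Hence the signs of the null
statistics are fair coins given their absolute values. Revealing them in the order of decreasing
absolute values gives a fair coin-tossing path, and bounds on its hitting probabilities show that
the largest ratio of the numbers of positive and negative null statistics, the latter increased by
`a`, has expectation at most `c_a`. A feasible threshold turns these ratios into a bound on the
proportion of false edges, which is linear in the ratios and hence can be summed over the nodes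
whatever their dependence. Missing edges are zeros of the precision matrix, that is, zero regression
coefficients at both ends. As the bound holds conditionally on the first half, it holds for
hyperparameters chosen with the help of that half.
-/

namespace GGMKnockoff

/-! ### Hitting bounds for random signs -/

section RandomSigns

variable {ι : Type*}

/-- The number of coordinates of `w` in `H` that are at least `t`. The number of those that are at
most `-t` is encoded as `posCount H (-w) t`. -/
noncomputable def posCount (H : Finset ι) (w : ι → ℝ) (t : ℝ) : ℕ :=
  (H.filter fun k => t ≤ w k).card

lemma posCount_congr {H : Finset ι} {w w' : ι → ℝ} (h : ∀ k ∈ H, w k = w' k) (t : ℝ) :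
    posCount H w t = posCount H w' t :=
  congrArg Finset.card (Finset.filter_congr fun k hk => by rw [h k hk])

lemma posCount_le_card (H : Finset ι) (w : ι → ℝ) (t : ℝ) : posCount H w t ≤ H.card :=
  Finset.card_filter_le _ _

lemma posCount_eq_zero {H : Finset ι} {w : ι → ℝ} {t : ℝ} (h : ∀ k ∈ H, w k < t) :
    posCount H w t = 0 :=
  Finset.card_eq_zero.2 (Finset.filter_eq_empty_iff.2 fun k hk => (h k hk).not_ge)

lemma posCount_insert [DecidableEq ι] {a : ι} {H : Finset ι} (ha : a ∉ H) (w : ι → ℝ) (t : ℝ) :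
    posCount (insert a H) w t = posCount H w t + if t ≤ w a then 1 else 0 := by
  unfold posCount
  rw [Finset.filter_insert]
  split_ifs
  · rw [Finset.card_insert_of_notMem fun h => ha (Finset.mem_of_mem_filter a h)]
  · rfl

/-- Some threshold in `Ts` brings the numbers of positive and negative coordinates in `H` beyond
that threshold, started from `(s, f)`, into `A`. -/
def Hits (A : ℕ → ℕ → Prop) (Ts : Set ℝ) (H : Finset ι) (w : ι → ℝ) (s f : ℕ) : Prop :=
  ∃ t ∈ Ts, A (s + posCount H w t) (f + posCount H (-w) t)

/-- `V s f` bounds the probability that a fair coin-tossing path with `s` successes and `f`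
failures so far ever enters `A`: it is a nonnegative supersolution off `A`, at least `1` on `A`. -/
structure IsHitBound (A : ℕ → ℕ → Prop) (V : ℕ → ℕ → ℝ) : Prop where
  nonneg : ∀ s f, 0 ≤ V s f
  one_le : ∀ s f, A s f → 1 ≤ V s f
  step : ∀ s f, ¬ A s f → V (s + 1) f + V s (f + 1) ≤ 2 * V s f

variable {A : ℕ → ℕ → Prop} {V : ℕ → ℕ → ℝ} {Ts : Set ℝ} {H : Finset ι} {w w' : ι → ℝ} {s f : ℕ}

lemma Hits.neg (h : Hits A Ts H w s f) : Hits (fun m n => A n m) Ts H (-w) f s := by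
  obtain ⟨t, ht, hA⟩ := h
  exact ⟨t, ht, by rwa [neg_neg]⟩

lemma Hits.congr (hw : ∀ k ∈ H, w k = w' k) (h : Hits A Ts H w s f) : Hits A Ts H w' s f := by
  obtain ⟨t, ht, hA⟩ := h
  refine ⟨t, ht, ?_⟩
  rwa [← posCount_congr hw,
    ← posCount_congr (w := -w) (w' := -w') fun k hk => congrArg Neg.neg (hw k hk)]

variable [DecidableEq ι] {a : ι}

/-- Any threshold that hits counts at least one coordinate, hence counts the largest one. -/
lemma Hits.of_insert_of_nonneg (hTs : ∀ t ∈ Ts, 0 < t) (ha : a ∉ H)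
    (hmax : ∀ k ∈ H, |w k| ≤ |w a|) (hA : ¬ A s f) (hwa : 0 ≤ w a)
    (h : Hits A Ts (insert a H) w s f) : Hits A Ts H w (s + 1) f := by
  obtain ⟨t, ht, hit⟩ := h
  have hta : t ≤ w a := by
    by_contra! hlt
    have hsmall : ∀ k ∈ insert a H, |w k| < t := by
      rw [← abs_of_nonneg hwa] at hlt
      exact Finset.forall_mem_insert _ _ _ |>.2 ⟨hlt, fun k hk => (hmax k hk).trans_lt hlt⟩
    rw [posCount_eq_zero fun k hk => (le_abs_self _).trans_lt (hsmall k hk),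
      posCount_eq_zero (w := -w) fun k hk => (neg_le_abs _).trans_lt (hsmall k hk)] at hit
    exact hA hit
  have hneg : ¬ t ≤ (-w) a := by
    have := hTs t ht
    simp only [Pi.neg_apply, not_le]
    linarith
  rw [posCount_insert ha, posCount_insert ha, if_pos hta, if_neg hneg, add_zero] at hit
  exact ⟨t, ht, by convert hit using 1; ring⟩

lemma Hits.of_insert_of_nonpos (hTs : ∀ t ∈ Ts, 0 < t) (ha : a ∉ H)
    (hmax : ∀ k ∈ H, |w k| ≤ |w a|) (hA : ¬ A s f) (hwa : w a ≤ 0)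
    (h : Hits A Ts (insert a H) w s f) : Hits A Ts H w s (f + 1) := by
  have := Hits.of_insert_of_nonneg (A := fun m n => A n m) hTs ha
    (by simpa only [Pi.neg_apply, abs_neg] using hmax) hA (neg_nonneg.2 hwa) h.neg
  simpa only [neg_neg] using this.neg

open Classical in
lemma ite_hits_insert_add_le (hTs : ∀ t ∈ Ts, 0 < t) (ha : a ∉ H)
    (hmax : ∀ k ∈ H, |w k| ≤ |w a|) (hA : ¬ A s f) :
    ((if Hits A Ts (insert a H) w s f then 1 else 0) +
        if Hits A Ts (insert a H) (Function.update w a (-w a)) s f then 1 else 0 : ℝ) ≤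
      (if Hits A Ts H w (s + 1) f then 1 else 0) + if Hits A Ts H w s (f + 1) then 1 else 0 := by
  have ite_mono {P Q : Prop} (hPQ : P → Q) : (if P then 1 else 0 : ℝ) ≤ if Q then 1 else 0 := by
    grind
  set w' := Function.update w a (-w a)
  have hw'a : w' a = -w a := Function.update_self ..
  have hw'H : ∀ k ∈ H, w' k = w k := fun k hk =>
    Function.update_of_ne (ne_of_mem_of_not_mem hk ha) ..
  have hmax' : ∀ k ∈ H, |w' k| ≤ |w' a| := fun k hk => by
    rw [hw'H k hk, hw'a, abs_neg]; exact hmax k hk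
  rcases le_total 0 (w a) with hwa | hwa
  · exact add_le_add (ite_mono (Hits.of_insert_of_nonneg hTs ha hmax hA hwa))
      (ite_mono fun h => (h.of_insert_of_nonpos hTs ha hmax' hA (by linarith)).congr hw'H)
  · rw [add_comm]
    exact add_le_add
      (ite_mono fun h => (h.of_insert_of_nonneg hTs ha hmax' hA (by linarith)).congr hw'H)
      (ite_mono (Hits.of_insert_of_nonpos hTs ha hmax hA hwa))

/-- Change the signs of the coordinates in `F`. -/
def flipOn (F : Finset ι) (w : ι → ℝ) : ι → ℝ := F.piecewise (-w) w

lemma flipOn_empty (w : ι → ℝ) : flipOn ∅ w = w := Finset.piecewise_empty ..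

lemma flipOn_zero (F : Finset ι) : flipOn F (0 : ι → ℝ) = 0 := by
  rw [flipOn, neg_zero, Finset.piecewise_same]

lemma flipOn_apply_of_notMem {F : Finset ι} (ha : a ∉ F) (w : ι → ℝ) : flipOn F w a = w a :=
  Finset.piecewise_eq_of_notMem _ _ _ ha

lemma flipOn_insert {F : Finset ι} (ha : a ∉ F) (w : ι → ℝ) :
    flipOn (insert a F) w = Function.update (flipOn F w) a (-flipOn F w a) := by
  rw [flipOn_apply_of_notMem ha]
  exact Finset.piecewise_insert ..

lemma abs_flipOn (F : Finset ι) (w : ι → ℝ) (k : ι) : |flipOn F w k| = |w k| := by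
  unfold flipOn Finset.piecewise
  split_ifs <;> simp

open Classical in
/-- Revealing the signs of the coordinates of `w` in the order of decreasing absolute values is a
fair coin-tossing path, and a threshold stops this path. -/
theorem IsHitBound.sum_hits_le (hV : IsHitBound A V) (hTs : ∀ t ∈ Ts, 0 < t) (w : ι → ℝ)
    (H : Finset ι) (s f : ℕ) :
    ∑ F ∈ H.powerset, (if Hits A Ts H (flipOn F w) s f then (1 : ℝ) else 0)
      ≤ 2 ^ H.card * V s f := by
  induction H using Finset.induction_on_max_value (fun k => |w k|) generalizing s f with
  | empty =>
    simp only [Finset.powerset_empty, Finset.sum_singleton, Finset.card_empty, pow_zero, one_mul]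
    split_ifs with h
    · obtain ⟨t, -, hA⟩ := h
      exact hV.one_le s f hA
    · exact hV.nonneg s f
  | insert a H ha hmax ih =>
    by_cases hA : A s f
    · calc _ ≤ ∑ _ ∈ (insert a H).powerset, (1 : ℝ) :=
            Finset.sum_le_sum fun _ _ => by split_ifs <;> norm_num
        _ = 2 ^ (insert a H).card * 1 := by simp
        _ ≤ _ := by gcongr; exact hV.one_le s f hA
    have hpair := fun F (hF : F ∈ H.powerset) => by
      have := ite_hits_insert_add_le (w := flipOn F w) hTs ha (by simpa only [abs_flipOn]) hA
      rwa [← flipOn_insert fun h => ha (Finset.mem_powerset.1 hF h)] at this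
    rw [Finset.sum_powerset_insert ha, Finset.card_insert_of_notMem ha, ← Finset.sum_add_distrib]
    calc _ ≤ _ := Finset.sum_le_sum hpair
      _ ≤ 2 ^ H.card * V (s + 1) f + 2 ^ H.card * V s (f + 1) := by
        rw [Finset.sum_add_distrib]
        exact add_le_add (ih _ _) (ih _ _)
      _ = 2 ^ H.card * (V (s + 1) f + V s (f + 1)) := by ring
      _ ≤ 2 ^ H.card * (2 * V s f) := by gcongr; exact hV.step s f hA
      _ = _ := by ring

end RandomSigns

/-! ### The expected maximal ratio of positive to negative counts -/

section MaxRatio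

/-- The largest ratio `#{k ∈ H : t ≤ w k} / (a + #{k ∈ H : w k ≤ -t})` over the positive
thresholds `t` among the absolute values of all coordinates of `w`. -/
noncomputable def maxRatio {ι : Type*} (a : ℝ) (H : Finset ι) (w : ι → ℝ) : ℝ≥0∞ :=
  ⨆ (j : ι) (_ : w j ≠ 0),
    (posCount H w |w j| : ℝ≥0∞) / (ENNReal.ofReal a + (posCount H (-w) |w j| : ℝ≥0∞))

/-- The constant `c` of the pair `(a, c)` bounds the average of `maxRatio a` over all sign patterns:
under independent fair signs its expectation is at most `c`. -/
def IsMaxRatioBound (a c : ℝ) : Prop :=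
  ∀ ⦃ι : Type⦄ [DecidableEq ι] (H : Finset ι) (w : ι → ℝ),
    ∑ F ∈ H.powerset, maxRatio a H (flipOn F w) ≤ 2 ^ H.card * ENNReal.ofReal c

/-- A layer-cake bound `c` for the part above `y` of the expected maximal ratio: levels
`y = x 0 ≤ x 1 ≤ …` tending to infinity, with hitting bounds for the events that the ratio of
successes to `a` plus failures exceeds `x i`, whose weighted sum is at most `c`. -/
def HasLayerBound (a y c : ℝ) : Prop :=
  ∃ (x : ℕ → ℝ) (V : ℕ → ℕ → ℕ → ℝ), x 0 = y ∧ Monotone x ∧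
    Filter.Tendsto x Filter.atTop Filter.atTop ∧
    (∀ i, IsHitBound (fun s f => x i * (a + f) < s) (V i)) ∧
    ∀ N, ∑ i ∈ Finset.range N, (x (i + 1) - x i) * V i 0 0 ≤ c

lemma le_add_sum_layers {x : ℕ → ℝ} (hx : Monotone x) {y : ℝ} {N : ℕ} (hy : y ≤ x N) :
    y ≤ x 0 + ∑ i ∈ Finset.range N, (x (i + 1) - x i) * (if x i < y then 1 else 0) := by
  induction N with
  | zero => simpa using hy
  | succ N ih =>
    rw [Finset.sum_range_succ]
    by_cases hN : x N < y
    · have hall : ∀ i ∈ Finset.range N,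
          (x (i + 1) - x i) * (if x i < y then (1 : ℝ) else 0) = x (i + 1) - x i := fun i hi => by
        rw [if_pos ((hx (Finset.mem_range.1 hi).le).trans_lt hN), mul_one]
      rw [Finset.sum_congr rfl hall, Finset.sum_range_sub, if_pos hN]
      linarith
    · simpa only [if_neg hN, mul_zero, add_zero] using ih (not_lt.1 hN)

variable {a y c : ℝ}

lemma posCount_div_eq_ofReal (ha : 0 < a) (m n : ℕ) :
    (m : ℝ≥0∞) / (ENNReal.ofReal a + n) = ENNReal.ofReal (m / (a + n)) := by
  rw [ENNReal.ofReal_div_of_pos (by positivity), ENNReal.ofReal_add ha.le (by positivity)]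
  simp only [ENNReal.ofReal_natCast]

/-- The absolute values of the non-zero coordinates of `w`. -/
def thresholdSet {ι : Type*} (w : ι → ℝ) : Set ℝ := {t | ∃ j, w j ≠ 0 ∧ t = |w j|}

lemma pos_of_mem_thresholdSet {ι : Type*} {w : ι → ℝ} {t : ℝ} (ht : t ∈ thresholdSet w) :
    0 < t := by
  obtain ⟨j, hj, rfl⟩ := ht
  exact abs_pos.2 hj

lemma thresholdSet_flipOn {ι : Type*} [DecidableEq ι] (F : Finset ι) (w : ι → ℝ) :
    thresholdSet (flipOn F w) = thresholdSet w := by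
  simp only [thresholdSet, ← abs_pos, abs_flipOn]

open Classical in
lemma maxRatio_le_sum_layers (ha : 0 < a) {x : ℕ → ℝ} (hx0 : x 0 = 0) (hx : Monotone x)
    {ι : Type*} {H : Finset ι} {N : ℕ} (hN : H.card / a ≤ x N) (w : ι → ℝ) :
    maxRatio a H w ≤ ENNReal.ofReal (∑ i ∈ Finset.range N, (x (i + 1) - x i) *
      if Hits (fun s f => x i * (a + f) < s) (thresholdSet w) H w 0 0 then 1 else 0) := by
  refine iSup₂_le fun j hj => ?_
  rw [posCount_div_eq_ofReal ha]
  refine ENNReal.ofReal_le_ofReal ?_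
  set P := posCount H w |w j|
  set M := posCount H (-w) |w j|
  have hpos : 0 < a + M := by positivity
  have hPN : P / (a + M) ≤ x N := by
    refine le_trans ?_ hN
    gcongr
    · exact posCount_le_card ..
    · exact le_add_of_nonneg_right M.cast_nonneg
  have hlayers := le_add_sum_layers hx hPN
  rw [hx0, zero_add] at hlayers
  refine hlayers.trans (Finset.sum_le_sum fun i _ =>
    mul_le_mul_of_nonneg_left ?_ (sub_nonneg.2 (hx i.le_succ)))
  have hhits : x i < P / (a + M) →
      Hits (fun s f => x i * (a + f) < s) (thresholdSet w) H w 0 0 := fun hi =>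
    ⟨|w j|, ⟨j, hj, rfl⟩, by simpa only [zero_add] using (lt_div_iff₀ hpos).1 hi⟩
  grind

theorem HasLayerBound.isMaxRatioBound (ha : 0 < a) (h : HasLayerBound a 0 c) :
    IsMaxRatioBound a c := by
  classical
  intro ι _ H w
  obtain ⟨x, V, hx0, hmono, htop, hV, hsum⟩ := h
  obtain ⟨N, hN⟩ := (htop.eventually_ge_atTop (H.card / a)).exists
  have hdx : ∀ i, 0 ≤ x (i + 1) - x i := fun i => sub_nonneg.2 (hmono i.le_succ)
  let hit (i : ℕ) (F : Finset ι) : ℝ :=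
    if Hits (fun s f => x i * (a + f) < s) (thresholdSet w) H (flipOn F w) 0 0 then 1 else 0
  have hit_nonneg (i : ℕ) (F : Finset ι) : 0 ≤ hit i F := ite_nonneg zero_le_one le_rfl
  calc ∑ F ∈ H.powerset, maxRatio a H (flipOn F w)
      ≤ ∑ F ∈ H.powerset,
          ENNReal.ofReal (∑ i ∈ Finset.range N, (x (i + 1) - x i) * hit i F) :=
        Finset.sum_le_sum fun F _ => by
          simpa only [thresholdSet_flipOn] using
            maxRatio_le_sum_layers ha hx0 hmono hN (flipOn F w)
    _ = ENNReal.ofReal (∑ i ∈ Finset.range N,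
          (x (i + 1) - x i) * ∑ F ∈ H.powerset, hit i F) := by
        rw [← ENNReal.ofReal_sum_of_nonneg fun F _ =>
          Finset.sum_nonneg fun i _ => mul_nonneg (hdx i) (hit_nonneg i F), Finset.sum_comm]
        simp only [Finset.mul_sum]
    _ ≤ ENNReal.ofReal (∑ i ∈ Finset.range N, (x (i + 1) - x i) * (2 ^ H.card * V i 0 0)) :=
        ENNReal.ofReal_le_ofReal <| Finset.sum_le_sum fun i _ => mul_le_mul_of_nonneg_left
          ((hV i).sum_hits_le (fun _ => pos_of_mem_thresholdSet) w H 0 0) (hdx i)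
    _ = ENNReal.ofReal (2 ^ H.card * ∑ i ∈ Finset.range N, (x (i + 1) - x i) * V i 0 0) := by
        rw [Finset.mul_sum]
        exact congrArg _ (Finset.sum_congr rfl fun i _ => by ring)
    _ ≤ ENNReal.ofReal (2 ^ H.card * c) := by gcongr; exact hsum N
    _ = 2 ^ H.card * ENNReal.ofReal c := by
        rw [ENNReal.ofReal_mul (by positivity), ENNReal.ofReal_pow zero_le_two,
          ENNReal.ofReal_ofNat]

lemma HasLayerBound.mono {c' : ℝ} (h : HasLayerBound a y c) (hc : c ≤ c') :
    HasLayerBound a y c' := by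
  obtain ⟨x, V, hx0, hmono, htop, hV, hsum⟩ := h
  exact ⟨x, V, hx0, hmono, htop, hV, fun N => (hsum N).trans hc⟩

lemma HasLayerBound.prepend {y' b : ℝ} {V : ℕ → ℕ → ℝ} (h : HasLayerBound a y' c)
    (hy : y ≤ y') (hV : IsHitBound (fun s f => y * (a + f) < s) V) (hb : V 0 0 ≤ b) :
    HasLayerBound a y (c + (y' - y) * b) := by
  obtain ⟨x, W, hx0, hmono, htop, hW, hsum⟩ := h
  have hyb : (y' - y) * V 0 0 ≤ (y' - y) * b :=
    mul_le_mul_of_nonneg_left hb (sub_nonneg.2 hy)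
  refine ⟨fun i => Nat.casesOn i y x, fun i => Nat.casesOn i V W, rfl,
    monotone_nat_of_le_succ ?_, (Filter.tendsto_add_atTop_iff_nat 1).1 htop, ?_, ?_⟩
  · rintro (_ | n)
    · exact hy.trans_eq hx0.symm
    · exact hmono n.le_succ
  · rintro (_ | n)
    · exact hV
    · exact hW n
  · rintro (_ | N)
    · have hc : 0 ≤ c := by simpa using hsum 0
      have := mul_nonneg (sub_nonneg.2 hy) (hV.nonneg 0 0)
      simp only [Finset.range_zero, Finset.sum_empty]
      linarith
    · rw [Finset.sum_range_succ']
      exact add_le_add (hsum N) (hx0.symm ▸ hyb : (x 0 - y) * V 0 0 ≤ (y' - y) * b)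

end MaxRatio

/-! ### Exponential hitting bounds and their exact refinement -/

section Levels

variable {A : ℕ → ℕ → Prop} {V : ℕ → ℕ → ℝ}

lemma isHitBound_one (A : ℕ → ℕ → Prop) : IsHitBound A fun _ _ => 1 :=
  ⟨fun _ _ => zero_le_one, fun _ _ _ => le_rfl, fun _ _ _ => by norm_num⟩

lemma isHitBound_exp {θ C : ℝ} (hθ0 : 0 ≤ θ) (hθ2 : θ ≤ 2) (hC : 0 ≤ C)
    (hA : ∀ s f, A s f → 1 ≤ C * (θ ^ s * (2 - θ) ^ f)) :
    IsHitBound A fun s f => C * (θ ^ s * (2 - θ) ^ f) where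
  nonneg s f := by
    have := sub_nonneg.2 hθ2
    positivity
  one_le := hA
  step s f _ := by
    rw [pow_succ, pow_succ]
    exact le_of_eq (by ring)

lemma isHitBound_exp_of_mul_add_le {θ : ℝ} {m r : ℕ} (hθ1 : 1 ≤ θ) (hθ2 : θ ≤ 2)
    (hθ : 1 ≤ (2 - θ) * θ ^ m) (hA : ∀ s f, A s f → m * f + r ≤ s) :
    IsHitBound A fun s f => 1 / θ ^ r * (θ ^ s * (2 - θ) ^ f) := by
  have := sub_nonneg.2 hθ2
  refine isHitBound_exp (by positivity) hθ2 (by positivity) fun s f h => ?_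
  rw [one_div_mul_eq_div, one_le_div (by positivity)]
  calc θ ^ r ≤ θ ^ r * ((2 - θ) * θ ^ m) ^ f :=
        le_mul_of_one_le_right (by positivity) (one_le_pow₀ hθ)
    _ = θ ^ (m * f + r) * (2 - θ) ^ f := by rw [mul_pow, pow_add, pow_mul]; ring
    _ ≤ θ ^ s * (2 - θ) ^ f := by gcongr; exact hA s f h

lemma isHitBound_exp_of_mul_lt_mul {θ : ℝ} {p q : ℕ} (hq : 0 < q) (hθ1 : 1 ≤ θ) (hθ2 : θ ≤ 2)
    (hθ : 1 ≤ (2 - θ) ^ q * θ ^ p) :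
    IsHitBound (fun s f => p * (1 + f) < q * s)
      fun s f => (2 - θ) * (θ ^ s * (2 - θ) ^ f) := by
  have hθ2' := sub_nonneg.2 hθ2
  refine isHitBound_exp (by positivity) hθ2 hθ2' fun s f h => ?_
  rw [← one_le_pow_iff_of_nonneg (by positivity) hq.ne']
  calc 1 ≤ ((2 - θ) ^ q * θ ^ p) ^ (1 + f) := one_le_pow₀ hθ
    _ = θ ^ (p * (1 + f)) * ((2 - θ) ^ (1 + f)) ^ q := by
        rw [mul_pow, ← pow_mul, ← pow_mul, ← pow_mul, mul_comm q, mul_comm]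
    _ ≤ θ ^ (q * s) * ((2 - θ) ^ (1 + f)) ^ q := by gcongr
    _ = _ := by rw [mul_comm q, pow_mul, ← mul_pow, pow_add, pow_one]; ring

lemma hasLayerBound_exp_tail {a c θ : ℝ} {m : ℕ} {r : ℕ → ℕ} (hθ1 : 1 ≤ θ) (hθ2 : θ ≤ 2)
    (hθ : 1 ≤ (2 - θ) * θ ^ m)
    (hr : ∀ i s f : ℕ, ((m + i : ℕ) : ℝ) * (a + f) < s → (m + i) * f + r i ≤ s)
    (hsum : ∀ N, ∑ i ∈ Finset.range N, 1 / θ ^ r i ≤ c) : HasLayerBound a m c := by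
  refine ⟨fun i => ((m + i : ℕ) : ℝ), fun i s f => 1 / θ ^ r i * (θ ^ s * (2 - θ) ^ f), rfl,
    Nat.mono_cast.comp fun i j hij => by gcongr,
    tendsto_natCast_atTop_atTop.comp
      (Filter.tendsto_atTop_mono (Nat.le_add_left · m) Filter.tendsto_id),
    fun i => isHitBound_exp_of_mul_add_le hθ1 hθ2 (hθ.trans ?_) (hr i), fun N => ?_⟩
  · exact mul_le_mul_of_nonneg_left (pow_le_pow_right₀ hθ1 (m.le_add_right i)) (sub_nonneg.2 hθ2)
  · refine (Finset.sum_congr rfl fun i _ => ?_).trans_le (hsum N)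
    push_cast
    ring

open Classical in
/-- One step of exact calculation, which improves a hitting bound. -/
noncomputable def hitStep (A : ℕ → ℕ → Prop) (V : ℕ → ℕ → ℝ) (s f : ℕ) : ℝ :=
  if A s f then 1 else (V (s + 1) f + V s (f + 1)) / 2

lemma IsHitBound.hitStep_le (h : IsHitBound A V) (s f : ℕ) : hitStep A V s f ≤ V s f := by
  unfold hitStep
  split_ifs with hA
  · exact h.one_le s f hA
  · linarith [h.step s f hA]

lemma IsHitBound.hitStep (h : IsHitBound A V) : IsHitBound A (hitStep A V) where
  nonneg s f := by
    unfold GGMKnockoff.hitStep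
    split_ifs
    · exact zero_le_one
    · linarith [h.nonneg (s + 1) f, h.nonneg s (f + 1)]
  one_le s f hA := (if_pos hA).ge
  step s f hA := by
    have hmid : GGMKnockoff.hitStep A V s f = (V (s + 1) f + V s (f + 1)) / 2 := if_neg hA
    linarith [h.hitStep_le (s + 1) f, h.hitStep_le s (f + 1)]

lemma IsHitBound.iterate_hitStep (h : IsHitBound A V) (k : ℕ) :
    IsHitBound A ((GGMKnockoff.hitStep A)^[k] V) := by
  induction k with
  | zero => exact h
  | succ k ih =>
    rw [Function.iterate_succ_apply']
    exact ih.hitStep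

/-- The list holds the values of `c * g` on the antidiagonal `s + f = k`, in the order of `s`. -/
structure IsRow (g : ℕ → ℕ → ℝ) (c : ℝ) (k : ℕ) (l : List ℕ) : Prop where
  length_eq : l.length = k + 1
  eq_mul : ∀ s (hs : s < l.length), (l[s] : ℝ) = c * g s (k - s)

/-- The integers `t ^ s * e ^ (f + 1)` on the antidiagonal `s + f = k`. -/
def baseRow (t e k : ℕ) : List ℕ := (List.range (k + 1)).map fun s => t ^ s * e ^ (k - s + 1)

/-- One application of `hitStep` for the level `p / q`, from an antidiagonal to the preceding one;
`u` stands for probability one on the new antidiagonal. -/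
def rowStep (p q u : ℕ) (l : List ℕ) : List ℕ :=
  List.zipWith (fun s v => if p * (l.length - 1 - s) < q * s then u else v)
    (List.range (l.length - 1)) (List.zipWith (· + ·) l l.tail)

/-- Step back from the antidiagonal `s + f = k`, where `u` stands for probability one, to the
origin. -/
def rowClimb (p q : ℕ) : ℕ → ℕ → List ℕ → ℕ
  | 0, _, l => l.headD 0
  | k + 1, u, l => rowClimb p q k (2 * u) (rowStep p q (2 * u) l)

lemma isRow_baseRow {t D : ℕ} (hD : 0 < D) (ht : t ≤ 2 * D) (k : ℕ) :
    IsRow (fun s f => (2 - (t : ℝ) / D) * (((t : ℝ) / D) ^ s * (2 - (t : ℝ) / D) ^ f))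
      ((D ^ (k + 1) : ℕ) : ℝ) k (baseRow t (2 * D - t) k) where
  length_eq := by simp [baseRow]
  eq_mul s hs := by
    obtain ⟨f, rfl⟩ : ∃ f, k = s + f :=
      Nat.exists_eq_add_of_le (by simpa [baseRow, Nat.lt_succ_iff] using hs)
    have hθ : 2 - (t : ℝ) / D = (2 * D - t) / D := by field_simp
    simp only [baseRow, List.getElem_map, List.getElem_range, Nat.add_sub_cancel_left, hθ, div_pow]
    push_cast [Nat.cast_sub ht]
    field_simp
    ring

lemma IsRow.rowStep {g : ℕ → ℕ → ℝ} {p q u k : ℕ} {l : List ℕ} (h : IsRow g u (k + 1) l) :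
    IsRow (GGMKnockoff.hitStep (fun s f => p * (1 + f) < q * s) g) ((2 * u : ℕ) : ℝ) k
      (rowStep p q (2 * u) l) where
  length_eq := by simp [GGMKnockoff.rowStep, h.length_eq]
  eq_mul s hs := by
    have hsk : s ≤ k := by
      simp only [GGMKnockoff.rowStep, List.length_zipWith, List.length_range, List.length_tail,
        h.length_eq] at hs
      omega
    have hl := h.length_eq
    simp only [GGMKnockoff.rowStep, List.getElem_zipWith, List.getElem_range, List.getElem_tail,
      GGMKnockoff.hitStep, hl]
    rw [show k + 1 + 1 - 1 - s = 1 + (k - s) by omega]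
    split_ifs
    · rw [mul_one]
    · rw [Nat.cast_add, h.eq_mul s (by omega), h.eq_mul (s + 1) (by omega),
        show k + 1 - s = k - s + 1 by omega, show k + 1 - (s + 1) = k - s by omega]
      push_cast
      ring

lemma rowClimb_eq {p q : ℕ} {g : ℕ → ℕ → ℝ} {k u : ℕ} {l : List ℕ} (h : IsRow g u k l) :
    (rowClimb p q k u l : ℝ) =
      2 ^ k * u * ((hitStep fun s f => p * (1 + f) < q * s)^[k] g) 0 0 := by
  induction k generalizing g u l with
  | zero =>
    obtain ⟨a, rfl⟩ := List.length_eq_one_iff.1 h.length_eq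
    simpa [rowClimb] using h.eq_mul 0 (by simp)
  | succ k ih =>
    rw [rowClimb, ih h.rowStep, Function.iterate_succ_apply]
    push_cast
    ring

/-! ### The constants of the two threshold families -/

/-- Data for a hitting bound at the level `num / den` for `a = 1`: the exponential bound with
parameter `theta / 1000`, refined by exact calculation to `bound / 10 ^ 6`. -/
structure LevelCert where
  num : ℕ
  den : ℕ
  theta : ℕ
  bound : ℕ

/-- The level of a certificate. -/
def LevelCert.level (e : LevelCert) : ℚ := e.num / e.den

/-- The integer inequalities that make `K` steps of exact calculation prove the bound. -/
def LevelCert.IsValid (K : ℕ) (e : LevelCert) : Prop :=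
  0 < e.den ∧ 1000 ≤ e.theta ∧ e.theta ≤ 2000 ∧
    1000 ^ (e.den + e.num) ≤ (2000 - e.theta) ^ e.den * e.theta ^ e.num ∧
    rowClimb e.num e.den K (1000 ^ (K + 1)) (baseRow e.theta (2000 - e.theta) K) * 10 ^ 6 ≤
      e.bound * (2 ^ K * 1000 ^ (K + 1))

instance (K : ℕ) : DecidablePred (LevelCert.IsValid K) := fun _ => instDecidableAnd

lemma LevelCert.IsValid.exists_isHitBound {K : ℕ} {e : LevelCert} (h : e.IsValid K) :
    ∃ V, IsHitBound (fun s f => (e.level : ℝ) * (1 + f) < s) V ∧ V 0 0 ≤ e.bound / 10 ^ 6 := by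
  obtain ⟨hden, hθ1, hθ2, hθ, hbound⟩ := h
  have hlevel : (fun s f : ℕ => (e.level : ℝ) * (1 + f) < s) =
      fun s f => e.num * (1 + f) < e.den * s := by
    ext s f
    rw [LevelCert.level, Rat.cast_div, Rat.cast_natCast, Rat.cast_natCast, div_mul_eq_mul_div,
      div_lt_iff₀' (by exact_mod_cast hden)]
    exact_mod_cast Iff.rfl
  have hexp : (1 : ℝ) ≤ (2 - e.theta / (1000 : ℕ)) ^ e.den * (e.theta / (1000 : ℕ)) ^ e.num := by
    rw [show (2 - e.theta / (1000 : ℕ) : ℝ) = ((2000 - e.theta : ℕ) : ℝ) / 1000 by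
      push_cast [hθ2]; ring, div_pow, div_pow, div_mul_div_comm, one_le_div (by positivity)]
    rw [pow_add] at hθ
    exact_mod_cast hθ
  have hV := isHitBound_exp_of_mul_lt_mul hden
    (by rw [one_le_div (by norm_num)]; exact_mod_cast hθ1)
    (by rw [div_le_iff₀ (by norm_num)]; exact_mod_cast hθ2) hexp
  rw [hlevel]
  refine ⟨_, hV.iterate_hitStep K, ?_⟩
  have hclimb := rowClimb_eq (p := e.num) (q := e.den)
    (isRow_baseRow (t := e.theta) (D := 1000) (by norm_num) hθ2 K)
  rw [le_div_iff₀ (by positivity),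
    ← mul_le_mul_iff_right₀ (show (0 : ℝ) < 2 ^ K * (1000 ^ (K + 1) : ℕ) by positivity),
    ← mul_assoc, ← hclimb, mul_comm _ (e.bound : ℝ)]
  exact_mod_cast hbound

/-- The lowest level of an increasing list of certificates below the level `top`. -/
def gridLevel (top : ℚ) : List LevelCert → ℚ
  | [] => top
  | e :: _ => e.level

/-- The layer-cake sum of the bounds in an increasing list of certificates below `top`. -/
def gridSum (top : ℚ) : List LevelCert → ℚ
  | [] => 0
  | e :: l => gridSum top l + (gridLevel top l - e.level) * (e.bound / 10 ^ 6)

/-- All certificates in the list are valid, and their levels increase up to `top`. -/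
def IsValidGrid (K : ℕ) (top : ℚ) : List LevelCert → Prop
  | [] => True
  | e :: l => e.IsValid K ∧ e.level ≤ gridLevel top l ∧ IsValidGrid K top l

instance (K : ℕ) (top : ℚ) : DecidablePred (IsValidGrid K top)
  | [] => instDecidableTrue
  | _ :: l =>
    have := instDecidablePredListLevelCertIsValidGrid K top l
    instDecidableAnd

lemma HasLayerBound.of_isValidGrid {K : ℕ} {top : ℚ} {c : ℝ} (h : HasLayerBound 1 top c)
    {l : List LevelCert} (hl : IsValidGrid K top l) :
    HasLayerBound 1 (gridLevel top l) (c + gridSum top l) := by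
  induction l with
  | nil => simpa [gridLevel, gridSum] using h
  | cons e l ih =>
    obtain ⟨he, hle, hl⟩ := hl
    obtain ⟨V, hV, hb⟩ := he.exists_isHitBound
    have := (ih hl).prepend (by exact_mod_cast hle) hV hb
    simpa [gridLevel, gridSum, add_assoc] using this

/-- Levels, exponential parameters and bounds found by numerical optimization. -/
def unitGrid : List LevelCert :=
  [⟨21, 20, 1048, 923229⟩, ⟨14, 13, 1074, 885637⟩, ⟨10, 9, 1105, 843025⟩,
   ⟨8, 7, 1132, 807099⟩, ⟨7, 6, 1153, 780135⟩, ⟨6, 5, 1180, 746012⟩, ⟨5, 4, 1220, 696870⟩,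
   ⟨9, 7, 1247, 671876⟩, ⟨4, 3, 1281, 624115⟩, ⟨11, 8, 1310, 602915⟩, ⟨7, 5, 1327, 585307⟩,
   ⟨13, 9, 1355, 565120⟩, ⟨3, 2, 1389, 499782⟩, ⟨14, 9, 1421, 486246⟩, ⟨8, 5, 1445, 466938⟩,
   ⟨5, 3, 1479, 433376⟩, ⟨7, 4, 1518, 410122⟩, ⟨9, 5, 1540, 399244⟩, ⟨15, 8, 1571, 387505⟩,
   ⟨2, 1, 1618, 236761⟩, ⟨13, 6, 1671, 227864⟩, ⟨9, 4, 1694, 216896⟩, ⟨7, 3, 1716, 203899⟩,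
   ⟨5, 2, 1754, 175305⟩, ⟨8, 3, 1787, 165648⟩, ⟨14, 5, 1810, 161614⟩, ⟨3, 1, 1839, 87391⟩,
   ⟨10, 3, 1877, 82890⟩, ⟨7, 2, 1892, 74677⟩, ⟨11, 3, 1906, 72960⟩, ⟨4, 1, 1927, 37581⟩,
   ⟨9, 2, 1950, 34417⟩, ⟨5, 1, 1965, 17321⟩]

set_option maxRecDepth 100000 in
lemma isValidGrid_unitGrid : IsValidGrid 48 6 unitGrid := by
  decide +kernel

end Levels

lemma sum_range_one_div_pow_le {θ : ℝ} (hθ : 1 < θ) (m N : ℕ) :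
    ∑ i ∈ Finset.range N, 1 / θ ^ (m + i) ≤ θ / (θ ^ m * (θ - 1)) := by
  have hθ1 : 0 < θ - 1 := sub_pos.2 hθ
  have := geom_sum_Ico_le_of_lt_one (m := m) (n := m + N) (inv_nonneg.2 (zero_le_one.trans hθ.le))
    (inv_lt_one_of_one_lt₀ hθ)
  rw [Finset.sum_Ico_eq_sum_range, Nat.add_sub_cancel_left] at this
  simp only [inv_pow] at this
  simp only [one_div]
  refine this.trans_eq ?_
  field_simp

lemma sum_range_mul_div (g : ℕ → ℝ) {d : ℕ} (hd : 0 < d) (N : ℕ) :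
    ∑ i ∈ Finset.range (d * N), g (i / d) = d * ∑ k ∈ Finset.range N, g k := by
  induction N with
  | zero => simp
  | succ N ih =>
    have hblock : ∀ i ∈ Finset.range d, g ((d * N + i) / d) = g N := fun i hi => by
      rw [Nat.mul_add_div hd, Nat.div_eq_of_lt (Finset.mem_range.1 hi), add_zero]
    rw [Nat.mul_succ, Finset.sum_range_add, ih, Finset.sum_congr rfl hblock, Finset.sum_const,
      Finset.card_range, nsmul_eq_mul, Finset.sum_range_succ, mul_add]

/-- The constant of Katsevich and Sabatti for the ratio `#{positive} / (1 + #{negative})`. -/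
theorem isMaxRatioBound_one : IsMaxRatioBound 1 1.93 := by
  have tail : HasLayerBound 1 ((6 : ℚ) : ℝ) (1.983 / (1.983 ^ 7 * (1.983 - 1))) := by
    have := hasLayerBound_exp_tail (a := 1) (θ := 1.983) (m := 6) (r := fun i => 7 + i)
      (by norm_num) (by norm_num) (by norm_num) (fun i s f h => by
        have : (6 + i) * (1 + f) < s := by exact_mod_cast h
        linarith) (sum_range_one_div_pow_le (by norm_num) 7)
    exact_mod_cast this
  have grid := tail.of_isValidGrid isValidGrid_unitGrid
  have from_one := grid.prepend (y := 1) (by norm_num [gridLevel, unitGrid, LevelCert.level])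
    (isHitBound_one _) le_rfl
  have from_zero := from_one.prepend zero_le_one (isHitBound_one _) le_rfl
  refine (from_zero.mono ?_).isMaxRatioBound one_pos
  norm_num [gridSum, gridLevel, unitGrid, LevelCert.level]

lemma sum_range_one_div_pow_centi_le (N : ℕ) :
    ∑ i ∈ Finset.range N, 1 / (1.995 : ℝ) ^ ((8 + i) / 100 + 1) ≤ 100 / 0.995 - 8 / 1.995 := by
  have hall : ∑ i ∈ Finset.range (8 + N), 1 / (1.995 : ℝ) ^ (i / 100 + 1) ≤ 100 / 0.995 := by
    calc _ ≤ ∑ i ∈ Finset.range (100 * (8 + N)), 1 / (1.995 : ℝ) ^ (i / 100 + 1) :=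
          Finset.sum_le_sum_of_subset_of_nonneg
            (Finset.range_subset_range.2 (by omega)) fun i _ _ => by positivity
      _ = 100 * ∑ k ∈ Finset.range (8 + N), 1 / (1.995 : ℝ) ^ (1 + k) := by
          simpa only [add_comm 1, Nat.cast_ofNat] using
            sum_range_mul_div (fun k => 1 / (1.995 : ℝ) ^ (k + 1)) (d := 100) (by norm_num) (8 + N)
      _ ≤ 100 * (1.995 / (1.995 ^ 1 * (1.995 - 1))) := by
          gcongr
          exact sum_range_one_div_pow_le (by norm_num) 1 _
      _ = 100 / 0.995 := by norm_num
  have hfirst : ∑ i ∈ Finset.range 8, 1 / (1.995 : ℝ) ^ (i / 100 + 1) = 8 / 1.995 := by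
    norm_num [Finset.sum_range_succ]
  rw [Finset.sum_range_add, hfirst] at hall
  exact le_sub_iff_add_le'.2 hall

theorem isMaxRatioBound_centi : IsMaxRatioBound 0.01 102 := by
  have hits {m s f : ℕ} (h : (m : ℝ) * (0.01 + f) < s) : m * f + (m / 100 + 1) ≤ s := by
    have hlt : m + 100 * (m * f) < 100 * s := by
      have : (m : ℝ) + 100 * (m * f) < 100 * s := by linarith
      exact_mod_cast this
    omega
  have tail : HasLayerBound 0.01 (8 : ℕ) (100 / 0.995 - 8 / 1.995) :=
    hasLayerBound_exp_tail (θ := 1.995) (by norm_num) (by norm_num) (by norm_num)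
      (fun _ _ _ => hits) sum_range_one_div_pow_centi_le
  have from_three := tail.prepend (y := (3 : ℕ)) (by norm_num)
    (isHitBound_exp_of_mul_add_le (θ := 1.83) (by norm_num) (by norm_num) (by norm_num)
      fun _ _ => hits) le_rfl
  have from_two := from_three.prepend (y := (2 : ℕ)) (by norm_num)
    (isHitBound_exp_of_mul_add_le (θ := 1.61) (by norm_num) (by norm_num) (by norm_num)
      fun _ _ => hits) le_rfl
  have from_zero := from_two.prepend (y := 0) (by norm_num) (isHitBound_one _) le_rfl
  exact (from_zero.mono (by norm_num)).isMaxRatioBound (by norm_num)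

section SignSymmetry

variable {ι E : Type*} [MeasurableSpace E] {ν : Measure E} {v w : E → ι → ℝ}

lemma measurable_posCount (H : Finset ι) {t : E → ℝ} (hv : Measurable v) (ht : Measurable t) :
    Measurable fun e => (posCount H (v e) (t e) : ℝ≥0∞) := by
  simp only [posCount, Finset.card_filter, Nat.cast_sum, Nat.cast_ite, Nat.cast_one, Nat.cast_zero]
  exact Finset.measurable_fun_sum _ fun k _ => Measurable.ite (measurableSet_le ht (by fun_prop))
    measurable_const measurable_const

lemma measurable_maxRatio [Countable ι] (a : ℝ) (H : Finset ι) (hw : Measurable w) :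
    Measurable fun e => maxRatio a H (w e) := by
  unfold maxRatio
  refine Measurable.iSup fun j => ?_
  have hj : Measurable fun e => |w e j| := by fun_prop
  simp only [iSup_eq_if]
  refine Measurable.ite ?_ ?_ measurable_const
  · exact (measurableSet_eq_fun (by fun_prop) measurable_const).compl
  · exact (measurable_posCount H hw hj).div
      (measurable_const.add (measurable_posCount H hw.neg hj))

variable [DecidableEq ι]

lemma measurable_flipOn (F : Finset ι) : Measurable (flipOn F) := by
  unfold flipOn Finset.piecewise
  refine measurable_pi_lambda _ fun k => ?_
  split_ifs <;> fun_prop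

lemma exists_measurePreserving_flipOn (H : Finset ι)
    (hflip : ∀ j ∈ H, ∃ R : E → E, MeasurePreserving R ν ν ∧ ∀ e, w (R e) = flipOn {j} (w e)) :
    ∃ R : E → E, MeasurePreserving R ν ν ∧ ∀ e, w (R e) = flipOn H (w e) := by
  induction H using Finset.induction_on with
  | empty => exact ⟨id, MeasurePreserving.id ν, fun e => (flipOn_empty _).symm⟩
  | insert a F ha ih =>
    obtain ⟨R, hR, hRw⟩ := ih fun j hj => hflip j (Finset.mem_insert_of_mem hj)
    obtain ⟨Q, hQ, hQw⟩ := hflip a (Finset.mem_insert_self a F)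
    refine ⟨Q ∘ R, hQ.comp hR, fun e => ?_⟩
    rw [Function.comp_apply, hQw, hRw, flipOn_insert ha, ← insert_empty_eq,
      flipOn_insert (Finset.notMem_empty a), flipOn_empty]

end SignSymmetry

theorem IsMaxRatioBound.lintegral_maxRatio_le {a c : ℝ} (hac : IsMaxRatioBound a c) {ι : Type}
    [Countable ι] [DecidableEq ι] {E : Type*} [MeasurableSpace E] {ν : Measure E}
    [IsProbabilityMeasure ν] {w : E → ι → ℝ} (hw : Measurable w) (H : Finset ι)
    (hflip : ∀ j ∈ H, ∃ R : E → E, MeasurePreserving R ν ν ∧ ∀ e, w (R e) = flipOn {j} (w e)) :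
    ∫⁻ e, maxRatio a H (w e) ∂ν ≤ ENNReal.ofReal c := by
  have hsymm : ∀ F ∈ H.powerset, ∫⁻ e, maxRatio a H (flipOn F (w e)) ∂ν =
      ∫⁻ e, maxRatio a H (w e) ∂ν := fun F hF => by
    obtain ⟨R, hR, hRw⟩ := exists_measurePreserving_flipOn F
      fun j hj => hflip j (Finset.mem_powerset.1 hF hj)
    simp only [← hRw]
    exact hR.lintegral_comp (measurable_maxRatio a H hw)
  have hsum : (2 : ℝ≥0∞) ^ H.card * ∫⁻ e, maxRatio a H (w e) ∂ν ≤
      2 ^ H.card * ENNReal.ofReal c := by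
    calc (2 : ℝ≥0∞) ^ H.card * ∫⁻ e, maxRatio a H (w e) ∂ν
        = ∑ F ∈ H.powerset, ∫⁻ e, maxRatio a H (flipOn F (w e)) ∂ν := by
          rw [Finset.sum_congr rfl hsymm]
          simp
      _ = ∫⁻ e, ∑ F ∈ H.powerset, maxRatio a H (flipOn F (w e)) ∂ν :=
          (lintegral_finsetSum _ fun F _ =>
            measurable_maxRatio a H ((measurable_flipOn F).comp hw)).symm
      _ ≤ ∫⁻ _, 2 ^ H.card * ENNReal.ofReal c ∂ν := lintegral_mono fun e => hac H (w e)
      _ = 2 ^ H.card * ENNReal.ofReal c := by simp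
  exact (ENNReal.mul_le_mul_iff_right (by positivity) (by simp)).1 hsum

/-! ### False discoveries and maximal ratios -/

section FalseDiscoveries

variable {p : ℕ} {r : EdgeRule} {q δ : ℝ} {ac : ℝ × ℝ} {W : Fin p → Fin p → ℝ}

lemma isFeasible_searchDown_or (k : ℕ) : IsFeasible r q δ ac W (searchDown r q δ ac W k) ∨
    searchDown r q δ ac W k = fun _ => ⊤ := by
  induction k with
  | zero => rw [searchDown]; split_ifs with h <;> simp [h]
  | succ k ih => rw [searchDown]; split_ifs with h <;> simp [h, ih]

lemma isFeasible_threshold_or : IsFeasible r q δ ac W (threshold r q δ ac W) ∨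
    threshold r q δ ac W = fun _ => ⊤ := by
  rw [threshold]
  split_ifs
  exacts [Or.inr rfl, isFeasible_searchDown_or _]

lemma posSet_top (i : Fin p) : posSet W i ⊤ = ∅ := by simp [posSet]

lemma estEdges_top : estEdges r W (fun _ => ⊤) = ∅ := by
  cases r <;> simp [estEdges, posSet_top, edgesOf]

lemma card_inter_posSet (H : Finset (Fin p)) (i : Fin p) (t : ℝ) :
    (H ∩ posSet W i t).card = posCount H (W i) t := by
  rw [posSet, posCount, Finset.inter_filter, Finset.inter_univ]
  simp only [EReal.coe_le_coe_iff]

lemma posCount_neg_le_card_negSet (H : Finset (Fin p)) (i : Fin p) (t : ℝ) :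
    posCount H (-W i) t ≤ (negSet W i t).card := by
  refine Finset.card_le_card fun k hk => ?_
  rw [negSet, Finset.mem_filter, ← EReal.coe_neg, EReal.coe_le_coe_iff]
  exact ⟨Finset.mem_univ k, le_neg.1 (Finset.mem_filter.1 hk).2⟩

lemma card_le_maxRatio_mul {a : ℝ} (ha : 0 < a) (H : Finset (Fin p)) (i : Fin p) {t : EReal}
    (ht : t ∈ thresholdCandidates W i) :
    ((H ∩ posSet W i t).card : ℝ≥0∞) ≤
      maxRatio a H (W i) * (ENNReal.ofReal a + ((negSet W i t).card : ℝ≥0∞)) := by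
  obtain ⟨ht0, rfl | ht⟩ := (Finset.mem_erase.trans (Iff.and Iff.rfl Finset.mem_insert)).1 ht
  · simp [posSet_top]
  obtain ⟨j, -, rfl⟩ := Finset.mem_image.1 ht
  have hj : W i j ≠ 0 := fun h => ht0 (by simp [h])
  have ha' : ENNReal.ofReal a ≠ 0 := by simpa using ha
  have hratio : (posCount H (W i) |W i j| : ℝ≥0∞) /
      (ENNReal.ofReal a + (posCount H (-W i) |W i j| : ℝ≥0∞)) ≤ maxRatio a H (W i) :=
    le_iSup₂ (f := fun j (_ : W i j ≠ 0) => (posCount H (W i) |W i j| : ℝ≥0∞) /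
      (ENNReal.ofReal a + (posCount H (-W i) |W i j| : ℝ≥0∞))) j hj
  rw [ENNReal.div_le_iff (by simp [ha']) (by simp)] at hratio
  rw [card_inter_posSet]
  refine hratio.trans ?_
  gcongr
  exact posCount_neg_le_card_negSet H i _

/-- The number of neighbourhood selections behind an edge. -/
def EdgeRule.mult : EdgeRule → ℕ
  | .AND => 2
  | .OR => 1

lemma EdgeRule.mult_pos (r : EdgeRule) : 0 < r.mult := by cases r <;> simp [mult]

lemma constraintLevel_eq (c : ℝ) : constraintLevel p r q c = r.mult * (q / (c * p)) := by
  cases r <;> simp [constraintLevel, EdgeRule.mult, mul_div_assoc]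

lemma mFDROffset_eq (h : Hyper p) : mFDROffset q h =
    ENNReal.ofReal (h.ac.1 * h.ac.2 * p) / ENNReal.ofReal (h.rule.mult * q) := by
  rw [mFDROffset]
  cases h.rule <;> simp [EdgeRule.mult, two_mul]

lemma sum_ite_add_ite_le_sum_card {α : Type*} [Fintype α] [LinearOrder α] {F : Finset (α × α)}
    (hF : ∀ e ∈ F, e.1 < e.2) (S : α → Finset α) :
    ∑ e ∈ F, ((if e.2 ∈ S e.1 then 1 else 0) + if e.1 ∈ S e.2 then 1 else 0) ≤
      ∑ i, (S i).card := by
  let ind (e : α × α) : ℕ := if e.2 ∈ S e.1 then 1 else 0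
  have hdisj : Disjoint F (F.map (Equiv.prodComm α α).toEmbedding) := by
    refine Finset.disjoint_left.2 fun e he he' => ?_
    obtain ⟨e', hmem, rfl⟩ := Finset.mem_map.1 he'
    exact (hF _ he).asymm (hF e' hmem)
  calc ∑ e ∈ F, (ind e + ind e.swap)
      = ∑ e ∈ F ∪ F.map (Equiv.prodComm α α).toEmbedding, ind e := by
        rw [Finset.sum_union hdisj, Finset.sum_add_distrib, Finset.sum_map]
        rfl
    _ ≤ ∑ e, ind e := Finset.sum_le_sum_of_subset (Finset.subset_univ _)
    _ = ∑ i, (S i).card := by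
        simp only [ind, Fintype.sum_prod_type, Finset.sum_ite_mem, Finset.univ_inter,
          Finset.sum_const, smul_eq_mul, mul_one]

open Classical in
lemma mult_card_le_sum {T : Fin p → EReal} {H : Fin p → Finset (Fin p)}
    {F : Finset (Fin p × Fin p)} (hF : F ⊆ estEdges r W T)
    (hH : ∀ e ∈ F, e.2 ∈ H e.1 ∧ e.1 ∈ H e.2) :
    r.mult * F.card ≤ ∑ i, (H i ∩ posSet W i (T i)).card := by
  have hmem := fun e (he : e ∈ F) => (Finset.mem_filter.1 (hF he)).2
  refine le_trans ?_ (sum_ite_add_ite_le_sum_card (fun e he => (hmem e he).1) _)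
  rw [mul_comm, ← smul_eq_mul]
  refine Finset.card_nsmul_le_sum F _ _ fun e he => ?_
  obtain ⟨-, hsel⟩ := hmem e he
  cases r <;> simp only [Finset.mem_inter, hH e he, true_and, EdgeRule.mult] at hsel ⊢ <;> grind

lemma card_div_le_sum_maxRatio {a c : ℝ} (ha : 0 < a) (hc : 0 < c) (hq : 0 ≤ q)
    {T : Fin p → EReal} (hT : ∀ i, T i ∈ thresholdCandidates W i) {H : Fin p → Finset (Fin p)}
    {F : Finset (Fin p × Fin p)} (hF : F ⊆ estEdges r W T)
    (hH : ∀ e ∈ F, e.2 ∈ H e.1 ∧ e.1 ∈ H e.2) {d : ℝ} (hd : 0 < d)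
    (hle : ∀ i, a + (negSet W i (T i)).card ≤ constraintLevel p r q c * d) :
    (F.card : ℝ≥0∞) / ENNReal.ofReal d ≤
      ENNReal.ofReal (q / (c * p)) * ∑ i, maxRatio a (H i) (W i) := by
  classical
  rw [ENNReal.div_le_iff (by simpa using hd) (by simp)]
  have hmult : (r.mult : ℝ≥0∞) * F.card ≤ r.mult *
      (ENNReal.ofReal (q / (c * p)) * (∑ i, maxRatio a (H i) (W i)) * ENNReal.ofReal d) := by
    calc (r.mult : ℝ≥0∞) * F.card ≤ ∑ i, ((H i ∩ posSet W i (T i)).card : ℝ≥0∞) := by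
          exact_mod_cast mult_card_le_sum hF hH
      _ ≤ ∑ i, maxRatio a (H i) (W i) * ENNReal.ofReal (r.mult * (q / (c * p)) * d) := by
          refine Finset.sum_le_sum fun i _ => (card_le_maxRatio_mul ha (H i) i (hT i)).trans ?_
          gcongr
          rw [← constraintLevel_eq, ← ENNReal.ofReal_natCast,
            ← ENNReal.ofReal_add ha.le (by positivity)]
          exact ENNReal.ofReal_le_ofReal (hle i)
      _ = _ := by
          rw [← Finset.sum_mul, ENNReal.ofReal_mul (by positivity),
            ENNReal.ofReal_mul (by positivity), ENNReal.ofReal_natCast]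
          ring
  exact (ENNReal.mul_le_mul_iff_right (by exact_mod_cast r.mult_pos.ne') (by simp)).1 hmult

theorem fdp_le_sum_maxRatio (ha : 0 < ac.1) (hc : 0 < ac.2) (hq : 0 ≤ q)
    {H : Fin p → Finset (Fin p)} {F : Finset (Fin p × Fin p)}
    (hF : F ⊆ estEdges r W (threshold r q 1 ac W)) (hH : ∀ e ∈ F, e.2 ∈ H e.1 ∧ e.1 ∈ H e.2) :
    (F.card : ℝ≥0∞) / max ((estEdges r W (threshold r q 1 ac W)).card : ℝ≥0∞) 1 ≤
      ENNReal.ofReal (q / (ac.2 * p)) * ∑ i, maxRatio ac.1 (H i) (W i) := by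
  rcases isFeasible_threshold_or (r := r) (q := q) (δ := 1) (ac := ac) (W := W) with h | h
  · have hd : (0 : ℝ) < max ((estEdges r W (threshold r q 1 ac W)).card : ℝ) 1 := by positivity
    simpa only [ENNReal.ofReal_max, ENNReal.ofReal_natCast, ENNReal.ofReal_one] using
      card_div_le_sum_maxRatio ha hc hq (fun i => (h i).2) hF hH hd fun i => by
        simpa only [mul_one] using (div_le_iff₀ hd).1 (h i).1
  · rw [h, estEdges_top, Finset.subset_empty] at hF
    simp [hF]

theorem mfdp_le_sum_maxRatio {h : Hyper p} (ha : 0 < h.ac.1) (hc : 0 < h.ac.2) (hq : 0 ≤ q)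
    {H : Fin p → Finset (Fin p)} {F : Finset (Fin p × Fin p)}
    (hF : F ⊆ estEdges h.rule W (threshold h.rule q 0 h.ac W))
    (hH : ∀ e ∈ F, e.2 ∈ H e.1 ∧ e.1 ∈ H e.2) :
    (F.card : ℝ≥0∞) /
        ((estEdges h.rule W (threshold h.rule q 0 h.ac W)).card + mFDROffset q h) ≤
      ENNReal.ofReal (q / (h.ac.2 * p)) * ∑ i, maxRatio h.ac.1 (H i) (W i) := by
  rcases F.eq_empty_or_nonempty with rfl | ⟨e, he⟩
  · simp
  have hp : 0 < p := e.1.pos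
  set E := estEdges h.rule W (threshold h.rule q 0 h.ac W) with hE
  have hE1 : (1 : ℝ) ≤ E.card := by exact_mod_cast Finset.card_pos.2 ⟨e, hF he⟩
  have hprod : 0 < h.ac.1 * h.ac.2 * p := by positivity
  rcases hq.eq_or_lt with rfl | hq
  · rw [mFDROffset_eq, mul_zero, ENNReal.ofReal_zero,
      ENNReal.div_zero (ENNReal.ofReal_pos.2 hprod).ne', add_top, ENNReal.div_top]
    exact zero_le
  have hm : (0 : ℝ) < h.rule.mult := by exact_mod_cast h.rule.mult_pos
  have hd : (0 : ℝ) < E.card + h.ac.1 * h.ac.2 * p / (h.rule.mult * q) := by positivity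
  have hoff : ENNReal.ofReal (E.card + h.ac.1 * h.ac.2 * p / (h.rule.mult * q)) =
      E.card + mFDROffset q h := by
    rw [mFDROffset_eq, ENNReal.ofReal_add (by positivity) (by positivity),
      ENNReal.ofReal_div_of_pos (by positivity), ENNReal.ofReal_natCast]
  rcases isFeasible_threshold_or (r := h.rule) (q := q) (δ := 0) (ac := h.ac) (W := W) with hT | hT
  · rw [← hoff]
    refine card_div_le_sum_maxRatio ha hc hq.le (fun i => (hT i).2) hF hH hd fun i => ?_
    have hcard := (div_le_iff₀ (by positivity)).1 (hT i).1
    rw [← hE, max_eq_left hE1, mul_zero, zero_add] at hcard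
    have hconst :
        constraintLevel p h.rule q h.ac.2 * (h.ac.1 * h.ac.2 * p / (h.rule.mult * q)) = h.ac.1 := by
      rw [constraintLevel_eq]
      field_simp
    rw [mul_add, hconst]
    linarith
  · rw [hE, hT, estEdges_top, Finset.subset_empty] at hF
    simp [hF]

end FalseDiscoveries

/-! ### Linear algebra of knockoffs -/

section KnockoffAlgebra

variable {m ι : Type*} [DecidableEq ι]

lemma col_swapCols (H : Finset ι) (A B : Matrix m ι ℝ) (k : ι) :
    (swapCols H A B).col k = if k ∈ H then B.col k else A.col k := by
  split_ifs with h <;> ext r <;> simp [swapCols, h]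

lemma scaleCols_eq_mul_diagonal [Fintype ι] (d : ι → ℝ) (X : Matrix m ι ℝ) :
    scaleCols d X = X * Matrix.diagonal (fun j => (d j)⁻¹) := by
  ext k j
  simp [scaleCols, div_eq_mul_inv]

variable [Fintype m] {A B X Xt : Matrix m ι ℝ} {d : ι → ℝ}

lemma isKnockoff_iff_dotProduct : IsKnockoff A B ↔ ∃ s : ι → ℝ, (∀ j, 0 ≤ s j) ∧ ∀ k l,
    A.col k ⬝ᵥ B.col l = A.col k ⬝ᵥ A.col l - (if k = l then s k else 0) ∧
    B.col k ⬝ᵥ A.col l = A.col k ⬝ᵥ A.col l - (if k = l then s k else 0) ∧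
    B.col k ⬝ᵥ B.col l = A.col k ⬝ᵥ A.col l := by
  refine exists_congr fun s => and_congr_right fun _ => ?_
  simp only [← Matrix.ext_iff, Matrix.mul_apply', Matrix.sub_apply, Matrix.diagonal_apply]
  exact ⟨fun h k l => ⟨h.1 k l, h.2.1 k l, h.2.2 k l⟩,
    fun h => ⟨fun k l => (h k l).1, fun k l => (h k l).2.1, fun k l => (h k l).2.2⟩⟩

lemma IsKnockoff.dotProduct_swapCols (h : IsKnockoff A B) (H : Finset ι) (k l : ι) :
    (swapCols H A B).col k ⬝ᵥ (swapCols H A B).col l = A.col k ⬝ᵥ A.col l ∧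
    (swapCols H A B).col k ⬝ᵥ (swapCols H B A).col l = A.col k ⬝ᵥ B.col l ∧
    (swapCols H B A).col k ⬝ᵥ (swapCols H A B).col l = B.col k ⬝ᵥ A.col l ∧
    (swapCols H B A).col k ⬝ᵥ (swapCols H B A).col l = B.col k ⬝ᵥ B.col l := by
  obtain ⟨s, -, hs⟩ := isKnockoff_iff_dotProduct.1 h
  obtain ⟨hAB, hBA, hBB⟩ := hs k l
  simp only [col_swapCols]
  grind

lemma IsKnockoff.swap (h : IsKnockoff A B) (H : Finset ι) :
    IsKnockoff (swapCols H A B) (swapCols H B A) := by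
  obtain ⟨s, hs0, hs⟩ := isKnockoff_iff_dotProduct.1 h
  refine isKnockoff_iff_dotProduct.2 ⟨s, hs0, fun k l => ?_⟩
  obtain ⟨hAA, hAB, hBA, hBB⟩ := h.dotProduct_swapCols H k l
  rw [hAA, hAB, hBA, hBB]
  exact hs k l

lemma IsKnockoff.gram_swapCols (h : IsKnockoff A B) (H : Finset ι) :
    (swapCols H A B).transpose * swapCols H A B = A.transpose * A :=
  Matrix.ext fun k l => (h.dotProduct_swapCols H k l).1

lemma IsKnockoff.gram_fromCols_swapCols (h : IsKnockoff A B) (H : Finset ι) :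
    (Matrix.fromCols (swapCols H A B) (swapCols H B A)).transpose *
        Matrix.fromCols (swapCols H A B) (swapCols H B A) =
      (Matrix.fromCols A B).transpose * Matrix.fromCols A B := by
  ext (k | k) (l | l)
  · exact (h.dotProduct_swapCols H k l).1
  · exact (h.dotProduct_swapCols H k l).2.1
  · exact (h.dotProduct_swapCols H k l).2.2.1
  · exact (h.dotProduct_swapCols H k l).2.2.2

lemma IsKnockoff.of_scaleCols (hd : ∀ j, d j ≠ 0)
    (h : IsKnockoff (scaleCols d X) (scaleCols d Xt)) : IsKnockoff X Xt := by
  obtain ⟨s, hs0, hs⟩ := isKnockoff_iff_dotProduct.1 h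
  refine isKnockoff_iff_dotProduct.2
    ⟨fun j => d j ^ 2 * s j, fun j => mul_nonneg (sq_nonneg _) (hs0 j), fun k l => ?_⟩
  have hscale (A B : Matrix m ι ℝ) :
      A.col k ⬝ᵥ B.col l = d k * d l * ((scaleCols d A).col k ⬝ᵥ (scaleCols d B).col l) := by
    rw [dotProduct, dotProduct, Finset.mul_sum]
    refine Finset.sum_congr rfl fun r _ => ?_
    have := hd k
    have := hd l
    simp only [scaleCols, Matrix.col_apply, Matrix.of_apply]
    field_simp
  have hdiag : (if k = l then d k ^ 2 * s k else 0) = d k * d l * if k = l then s k else 0 := by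
    split_ifs with hkl
    · rw [hkl]; ring
    · ring
  obtain ⟨hAB, hBA, hBB⟩ := hs k l
  rw [hscale X Xt, hscale Xt X, hscale Xt Xt, hscale X X, hAB, hBA, hBB, hdiag, ← mul_sub]
  exact ⟨rfl, rfl, rfl⟩

variable [Fintype ι]

lemma IsStrategySolution.nonneg {o : OptStrategy} {s : ι → ℝ}
    (h : IsStrategySolution o (X.transpose * X) s) (j : ι) : 0 ≤ s j := by
  cases o with
  | equi =>
    rw [h j]
    refine le_min (mul_nonneg zero_le_two (Real.sInf_nonneg fun x hx => ?_)) zero_le_one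
    have hpsd : (X.transpose * X).PosSemidef := by
      simpa using Matrix.posSemidef_conjTranspose_mul_self X
    rw [hpsd.isHermitian.spectrum_real_eq_range_eigenvalues] at hx
    obtain ⟨k, rfl⟩ := hx
    exact hpsd.eigenvalues_nonneg k
  | sdp => exact (h.1.2 j).1

lemma IsConstructedKnockoff.isKnockoff {o : OptStrategy} (h : IsConstructedKnockoff o X Xt)
    (hX : IsUnit (X.transpose * X).det) : IsKnockoff X Xt := by
  obtain ⟨s, U, C, hs, hUU, hUX, hCC, rfl⟩ := h
  have hXU : X.transpose * U = 0 := by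
    simpa [Matrix.transpose_mul] using congrArg Matrix.transpose hUX
  set G := X.transpose * X with hG
  set S := Matrix.diagonal s with hS
  have hGG : G * G⁻¹ = 1 := Matrix.mul_nonsing_inv G hX
  have hXXt : X.transpose * (X * (1 - G⁻¹ * S) + U * C) = G - S := by
    rw [Matrix.mul_add, ← Matrix.mul_assoc, ← Matrix.mul_assoc, hXU, Matrix.zero_mul, add_zero,
      ← hG, mul_sub, mul_one, ← mul_assoc, hGG, one_mul]
  have hXtX : (X * (1 - G⁻¹ * S) + U * C).transpose * X = G - S := by
    simpa [Matrix.transpose_mul, hG, hS] using congrArg Matrix.transpose hXXt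
  have hXtU : (X * (1 - G⁻¹ * S) + U * C).transpose * (U * C) = C.transpose * C := by
    rw [Matrix.transpose_add, Matrix.transpose_mul, Matrix.transpose_mul, Matrix.add_mul,
      ← Matrix.mul_assoc, Matrix.mul_assoc _ X.transpose U, hXU, Matrix.mul_zero, Matrix.zero_mul,
      zero_add, ← Matrix.mul_assoc, Matrix.mul_assoc _ U.transpose U, hUU, mul_one]
  refine ⟨s, hs.nonneg, hXXt, hXtX, ?_⟩
  rw [Matrix.mul_add, hXtU, ← Matrix.mul_assoc, hXtX, hCC, sub_mul, mul_sub, mul_one, ← mul_assoc,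
    hGG, one_mul, mul_sub, mul_one, two_smul, mul_assoc]
  abel

lemma colNorm_ne_zero (hX : IsUnit (X.transpose * X).det) (j : ι) : colNorm X j ≠ 0 := by
  intro h
  rw [colNorm, Real.sqrt_eq_zero (Finset.sum_nonneg fun _ _ => sq_nonneg _),
    Finset.sum_eq_zero_iff_of_nonneg fun _ _ => sq_nonneg _] at h
  have hcol (k : m) : X k j = 0 := by simpa using h k (Finset.mem_univ k)
  exact hX.ne_zero <| Matrix.det_eq_zero_of_row_eq_zero j fun l => by simp [Matrix.mul_apply, hcol]

lemma isUnit_gram_scaleCols (hd : ∀ j, d j ≠ 0) (hX : IsUnit (X.transpose * X).det) :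
    IsUnit ((scaleCols d X).transpose * scaleCols d X).det := by
  have hdiag : IsUnit (Matrix.diagonal fun j => (d j)⁻¹).det := by
    rw [Matrix.det_diagonal, isUnit_iff_ne_zero, Finset.prod_ne_zero_iff]
    exact fun j _ => inv_ne_zero (hd j)
  rw [scaleCols_eq_mul_diagonal, Matrix.transpose_mul, Matrix.diagonal_transpose,
    Matrix.mul_assoc, ← Matrix.mul_assoc _ X, ← mul_assoc, Matrix.det_mul, Matrix.det_mul]
  exact (hdiag.mul hX).mul hdiag

end KnockoffAlgebra

lemma IsKnockoffRule.isKnockoff {p : ℕ} {std : Bool} {o : OptStrategy} {K : KnockoffRule p}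
    (hK : IsKnockoffRule std o K) {n : ℕ} (i : Fin p) {X : Matrix (Fin n) (Others i) ℝ}
    (hn : 2 * Fintype.card (Others i) ≤ n) (hX : IsUnit (X.transpose * X).det) :
    IsKnockoff X (K n i X) := by
  have h := hK.constructed n i X hn hX
  cases std with
  | true =>
    have hd := colNorm_ne_zero hX
    exact (IsConstructedKnockoff.isKnockoff h (isUnit_gram_scaleCols hd hX)).of_scaleCols hd
  | false => exact IsConstructedKnockoff.isKnockoff h hX

/-! ### Reflections exchanging a variable with its knockoff -/

section Reflection

variable {m ι : Type*} [Fintype m]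

/-- The reflection of `m → ℝ`, with its Euclidean structure, in the hyperplane orthogonal to `v`. -/
noncomputable def reflectAlong (v : m → ℝ) : (m → ℝ) →ₗ[ℝ] m → ℝ :=
  (WithLp.linearEquiv 2 ℝ (m → ℝ)).conj
    ((ℝ ∙ (WithLp.toLp 2 v : EuclideanSpace ℝ m))ᗮ.reflection : _ →ₗ[ℝ] _)

lemma toLp_reflectAlong (v x : m → ℝ) : WithLp.toLp 2 (reflectAlong v x) =
    (ℝ ∙ (WithLp.toLp 2 v : EuclideanSpace ℝ m))ᗮ.reflection (WithLp.toLp 2 x) := rfl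

lemma reflectAlong_reflectAlong (v x : m → ℝ) : reflectAlong v (reflectAlong v x) = x := by
  apply WithLp.toLp_injective 2
  rw [toLp_reflectAlong, toLp_reflectAlong, Submodule.reflection_reflection]

lemma dotProduct_reflectAlong (v x y : m → ℝ) :
    x ⬝ᵥ reflectAlong v y = reflectAlong v x ⬝ᵥ y := by
  have hinner (a b : m → ℝ) :
      a ⬝ᵥ b = inner ℝ (WithLp.toLp 2 a : EuclideanSpace ℝ m) (WithLp.toLp 2 b) := by
    rw [EuclideanSpace.inner_toLp_toLp, star_trivial, dotProduct_comm]
  rw [hinner, hinner, toLp_reflectAlong, toLp_reflectAlong,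
    LinearIsometryEquiv.inner_map_eq_flip, Submodule.reflection_symm]

lemma reflectAlong_of_dotProduct_eq_zero {v x : m → ℝ} (h : v ⬝ᵥ x = 0) :
    reflectAlong v x = x := by
  apply WithLp.toLp_injective 2
  rw [toLp_reflectAlong, Submodule.reflection_mem_subspace_eq_self]
  rwa [Submodule.mem_orthogonal_singleton_iff_inner_right, EuclideanSpace.inner_toLp_toLp,
    star_trivial, dotProduct_comm]

lemma reflectAlong_sub {x y : m → ℝ} (h : x ⬝ᵥ x = y ⬝ᵥ y) : reflectAlong (x - y) x = y := by
  apply WithLp.toLp_injective 2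
  refine Submodule.reflection_sub ?_
  rw [EuclideanSpace.norm_eq, EuclideanSpace.norm_eq]
  simpa [dotProduct, sq] using congrArg Real.sqrt h

lemma measurePreserving_reflectAlong (σ : NNReal) (v : m → ℝ) :
    MeasurePreserving (reflectAlong v) (Measure.pi fun _ => gaussianReal 0 σ)
      (Measure.pi fun _ => gaussianReal 0 σ) := by
  have hstd : MeasurePreserving (reflectAlong v) (Measure.pi fun _ => gaussianReal 0 1)
      (Measure.pi fun _ => gaussianReal 0 1) := by
    have htoLp : MeasurePreserving (MeasurableEquiv.toLp 2 (m → ℝ))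
        (Measure.pi fun _ => gaussianReal 0 1) (stdGaussian (EuclideanSpace ℝ m)) :=
      ⟨MeasurableEquiv.measurable _, map_pi_eq_stdGaussian⟩
    have hrefl : MeasurePreserving (ℝ ∙ (WithLp.toLp 2 v : EuclideanSpace ℝ m))ᗮ.reflection
        (stdGaussian (EuclideanSpace ℝ m)) (stdGaussian (EuclideanSpace ℝ m)) :=
      ⟨(LinearIsometryEquiv.continuous _).measurable, stdGaussian_map _⟩
    exact htoLp.symm.comp (hrefl.comp htoLp)
  have hscale : MeasurePreserving (fun x : m → ℝ => √σ • x)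
      (Measure.pi fun _ => gaussianReal 0 1) (Measure.pi fun _ => gaussianReal 0 σ) := by
    refine measurePreserving_pi (fun _ : m => gaussianReal 0 1) (fun _ => gaussianReal 0 σ)
      (f := fun _ x => √σ * x) fun _ => ⟨by fun_prop, ?_⟩
    rw [gaussianReal_map_const_mul]
    congr 1
    · simp
    · ext
      simp
  refine ⟨hstd.measurable, ?_⟩
  rw [← hscale.map_eq, Measure.map_map hstd.measurable hscale.measurable]
  simp only [Function.comp_def, map_smul]
  exact (hscale.comp hstd).map_eq.trans hscale.map_eq.symm

variable [DecidableEq ι] {D Dt : Matrix m ι ℝ}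

lemma IsKnockoff.reflectAlong_col (h : IsKnockoff D Dt) (j k : ι) :
    reflectAlong (D.col j - Dt.col j) (D.col k) = (swapCols {j} D Dt).col k ∧
    reflectAlong (D.col j - Dt.col j) (Dt.col k) = (swapCols {j} Dt D).col k := by
  obtain ⟨s, -, hs⟩ := isKnockoff_iff_dotProduct.1 h
  simp only [col_swapCols, Finset.mem_singleton]
  split_ifs with hk
  · subst hk
    have hswap := reflectAlong_sub (hs k k).2.2.symm
    refine ⟨hswap, ?_⟩
    nth_rw 2 [← hswap]
    exact reflectAlong_reflectAlong ..
  · obtain ⟨hDDt, hDtD, hDtDt⟩ := hs j k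
    rw [if_neg (Ne.symm hk), sub_zero] at hDDt hDtD
    constructor <;> apply reflectAlong_of_dotProduct_eq_zero <;> rw [sub_dotProduct]
    · rw [hDtD, sub_self]
    · rw [hDDt, hDtDt, sub_self]

lemma IsKnockoff.mulVec_reflectAlong (h : IsKnockoff D Dt) (j : ι) (y : m → ℝ) :
    (Matrix.fromCols D Dt).transpose.mulVec (reflectAlong (D.col j - Dt.col j) y) =
      (Matrix.fromCols (swapCols {j} D Dt) (swapCols {j} Dt D)).transpose.mulVec y := by
  ext (k | k)
  · exact (dotProduct_reflectAlong _ (D.col k) y).trans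
      (congrArg (· ⬝ᵥ y) (h.reflectAlong_col j k).1)
  · exact (dotProduct_reflectAlong _ (Dt.col k) y).trans
      (congrArg (· ⬝ᵥ y) (h.reflectAlong_col j k).2)

lemma IsKnockoff.reflectAlong_mulVec [Fintype ι] (h : IsKnockoff D Dt) {j : ι} {β : ι → ℝ}
    (hβ : β j = 0) : reflectAlong (D.col j - Dt.col j) (D.mulVec β) = D.mulVec β := by
  rw [Matrix.mulVec_eq_sum, map_sum]
  refine Finset.sum_congr rfl fun k _ => ?_
  rw [op_smul_eq_smul, map_smul]
  by_cases hk : k = j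
  · rw [hk, hβ, zero_smul, zero_smul]
  · refine congrArg _ ((h.reflectAlong_col j k).1.trans ?_)
    rw [col_swapCols, if_neg (Finset.notMem_singleton.2 hk)]
    rfl

end Reflection

lemma HasAntisymmetry.apply_eq_of_mulVec_eq {p : ℕ} {P : FeatureProcedure p}
    (ha : HasAntisymmetry P) (hs : HasSufficiency P) {n : ℕ} {i : Fin p}
    {A B : Matrix (Fin n) (Others i) ℝ} (hA : IsUnit (A.transpose * A).det) (hAB : IsKnockoff A B)
    (H : Finset (Others i)) {y y' : Fin n → ℝ}
    (hy : (Matrix.fromCols A B).transpose.mulVec y' =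
      (Matrix.fromCols (swapCols H A B) (swapCols H B A)).transpose.mulVec y) (j : Others i) :
    P n i A B y' j = if j ∈ H then - P n i A B y j else P n i A B y j := by
  obtain ⟨f, -, hf⟩ := hs n i
  rw [← ha n i A B y hA hAB H j, hf A B y' hA hAB, hf (swapCols H A B) (swapCols H B A) y
    (by rwa [hAB.gram_swapCols]) (hAB.swap H), hAB.gram_fromCols_swapCols, hy]

/-! ### Linear forms of a Gaussian vector -/

section LinearForms

variable {p : ℕ} {S : Matrix (Fin p) (Fin p) ℝ}

lemma dotProduct_ofLp_eq_inner (a : Fin p → ℝ) (x : EuclideanSpace ℝ (Fin p)) :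
    a ⬝ᵥ x.ofLp = inner ℝ (WithLp.toLp 2 a : EuclideanSpace ℝ (Fin p)) x := by
  rw [EuclideanSpace.inner_eq_star_dotProduct, star_trivial, dotProduct_comm]

lemma covariance_dotProduct (hS : S.PosSemidef) (a b : Fin p → ℝ) :
    cov[fun x : EuclideanSpace ℝ (Fin p) => a ⬝ᵥ x.ofLp,
      fun x : EuclideanSpace ℝ (Fin p) => b ⬝ᵥ x.ofLp; multivariateGaussian 0 S] =
      a ⬝ᵥ S.mulVec b := by
  have h := covarianceBilin_multivariateGaussian (μ := 0) hS (WithLp.toLp 2 a) (WithLp.toLp 2 b)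
  rw [covarianceBilin_apply_eq_cov IsGaussian.memLp_two_id] at h
  simpa only [dotProduct_ofLp_eq_inner] using h

lemma hasGaussianLaw_dotProduct (a : Fin p → ℝ) :
    HasGaussianLaw (fun x : EuclideanSpace ℝ (Fin p) => a ⬝ᵥ x.ofLp)
      (multivariateGaussian 0 S) := by
  simp only [dotProduct_ofLp_eq_inner]
  exact IsGaussian.hasGaussianLaw_id.map_fun (innerSL ℝ (WithLp.toLp 2 a))

lemma integral_dotProduct (a : Fin p → ℝ) :
    ∫ x : EuclideanSpace ℝ (Fin p), a ⬝ᵥ x.ofLp ∂multivariateGaussian 0 S = 0 := by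
  simp only [dotProduct_ofLp_eq_inner]
  have h := (innerSL ℝ (WithLp.toLp 2 a : EuclideanSpace ℝ (Fin p))).integral_comp_id_comm
    (μ := multivariateGaussian 0 S) IsGaussian.integrable_id
  rwa [integral_id_multivariateGaussian, map_zero] at h

lemma integral_dotProduct_mul_apply (hS : S.PosSemidef) (a : Fin p → ℝ) (j : Fin p) :
    ∫ x : EuclideanSpace ℝ (Fin p), a ⬝ᵥ x.ofLp * x j ∂multivariateGaussian 0 S =
      a ⬝ᵥ S.col j := by
  have h := covariance_dotProduct hS a (Pi.single j 1)
  rw [covariance, integral_dotProduct, integral_dotProduct, Matrix.mulVec_single_one] at h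
  simpa only [sub_zero, single_one_dotProduct] using h

lemma indepFun_dotProduct_apply (hS : S.PosSemidef) {K : Type*} [Finite K] (a : Fin p → ℝ)
    (b : K → Fin p) (h : ∀ k, a ⬝ᵥ S.col (b k) = 0) :
    IndepFun (fun x : EuclideanSpace ℝ (Fin p) => a ⬝ᵥ x.ofLp)
      (fun (x : EuclideanSpace ℝ (Fin p)) k => x (b k)) (multivariateGaussian 0 S) := by
  have := Fintype.ofFinite K
  have hcoord (x : EuclideanSpace ℝ (Fin p)) (k : K) :
      x (b k) = Pi.single (b k) 1 ⬝ᵥ x.ofLp := by rw [single_one_dotProduct]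
  have hindep : IndepFun (fun (x : EuclideanSpace ℝ (Fin p)) (_ : Unit) => a ⬝ᵥ x.ofLp)
      (fun (x : EuclideanSpace ℝ (Fin p)) k => x (b k)) (multivariateGaussian 0 S) := by
    simp only [hcoord]
    refine HasGaussianLaw.indepFun_of_covariance_eval ?_ fun _ k => ?_
    · simp only [dotProduct_ofLp_eq_inner]
      exact IsGaussian.hasGaussianLaw_id.map_fun
        ((ContinuousLinearMap.pi fun _ : Unit => innerSL ℝ (WithLp.toLp 2 a)).prod
          (ContinuousLinearMap.pi fun k : K =>
            innerSL ℝ (WithLp.toLp 2 (Pi.single (b k) 1) : EuclideanSpace ℝ (Fin p))))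
    · rw [covariance_dotProduct hS, Matrix.mulVec_single_one, h]
  exact hindep.comp (measurable_pi_apply ()) measurable_id

end LinearForms

/-! ### Missing edges and zeros of the precision matrix -/

section CondExp

variable {Ω : Type*} {m mΩ : MeasurableSpace Ω} {μ : Measure Ω} [IsFiniteMeasure μ] {f g : Ω → ℝ}

lemma integral_mul_condExp (hm : m ≤ mΩ) (hf : MemLp f 2 μ) (hg : MemLp g 2 μ) :
    ∫ ω, f ω * (μ[g | m]) ω ∂μ = ∫ ω, (μ[f | m]) ω * (μ[g | m]) ω ∂μ := by
  rw [← integral_condExp hm]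
  exact integral_congr_ae (condExp_mul_of_stronglyMeasurable_right stronglyMeasurable_condExp
    (hf.integrable_mul (hg.condExp one_le_two)) (hf.integrable one_le_two))

omit [IsFiniteMeasure μ] in
lemma integral_mul_sub_condExp (hf : MemLp f 2 μ) (hg : MemLp g 2 μ) :
    ∫ ω, f ω * (g ω - (μ[g | m]) ω) ∂μ = ∫ ω, f ω * g ω ∂μ - ∫ ω, f ω * (μ[g | m]) ω ∂μ := by
  simp only [mul_sub]
  exact integral_sub (hf.integrable_mul hg) (hf.integrable_mul (hg.condExp one_le_two))

lemma integral_mul_sub_condExp_of_stronglyMeasurable (hm : m ≤ mΩ) (hfm : StronglyMeasurable[m] f)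
    (hf : MemLp f 2 μ) (hg : MemLp g 2 μ) : ∫ ω, f ω * (g ω - (μ[g | m]) ω) ∂μ = 0 := by
  have h := integral_mul_condExp hm hg hf
  rw [condExp_of_stronglyMeasurable hm hfm (hf.integrable one_le_two)] at h
  rw [integral_mul_sub_condExp hf hg, sub_eq_zero]
  simpa only [mul_comm] using h

lemma integral_mul_sub_condExp_of_condIndepFun [StandardBorelSpace Ω] {hm : m ≤ mΩ}
    (h : CondIndepFun m hm f g μ) (hfm : Measurable f) (hgm : Measurable g) (hf : MemLp f 2 μ)
    (hg : MemLp g 2 μ) : ∫ ω, f ω * (g ω - (μ[g | m]) ω) ∂μ = 0 := by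
  have hindep : ∀ᵐ ω ∂μ, IndepFun f g (condExpKernel μ m ω) := by
    have hprod := (Kernel.indepFun_iff_compProd_map_prod_eq_compProd_prod_map_map hfm hgm).1 h
    refine ae_of_ae_trim hm ?_
    filter_upwards [Kernel.ae_eq_of_compProd_eq hprod] with ω hω
    rwa [Kernel.map_apply _ (by fun_prop), Kernel.prod_apply, Kernel.map_apply _ hfm,
      Kernel.map_apply _ hgm,
      ← indepFun_iff_map_prod_eq_prod_map_map hfm.aemeasurable hgm.aemeasurable] at hω
  have hcond : μ[fun ω => f ω * g ω | m] =ᵐ[μ] fun ω => (μ[f | m]) ω * (μ[g | m]) ω := by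
    filter_upwards [hindep, condExp_ae_eq_integral_condExpKernel hm (hf.integrable one_le_two),
      condExp_ae_eq_integral_condExpKernel hm (hg.integrable one_le_two),
      condExp_ae_eq_integral_condExpKernel hm (hf.integrable_mul hg)] with ω hω hfω hgω hfgω
    rw [hfω, hgω]
    exact hfgω.trans <| hω.integral_fun_mul_eq_mul_integral hfm.aestronglyMeasurable
      hgm.aestronglyMeasurable
  rw [integral_mul_sub_condExp hf hg, integral_mul_condExp hm hf hg, ← integral_condExp hm,
    integral_congr_ae hcond, sub_self]

end CondExp

section Precision

variable {p : ℕ} {Om : Matrix (Fin p) (Fin p) ℝ}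

lemma row_dotProduct_inv_col (hOm : Om.PosDef) (k l : Fin p) :
    Om k ⬝ᵥ Om⁻¹.col l = if k = l then 1 else 0 := by
  rw [← Matrix.one_apply,
    ← Matrix.mul_nonsing_inv Om ((Matrix.isUnit_iff_isUnit_det _).1 hOm.isUnit)]
  rfl

lemma indepFun_row_apply (hOm : Om.PosDef) {K : Type*} [Finite K] {k : Fin p} {b : K → Fin p}
    (hb : ∀ l, b l ≠ k) :
    IndepFun (fun x : EuclideanSpace ℝ (Fin p) => Om k ⬝ᵥ x.ofLp)
      (fun (x : EuclideanSpace ℝ (Fin p)) l => x (b l)) (multivariateGaussian 0 Om⁻¹) :=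
  indepFun_dotProduct_apply hOm.inv.posSemidef _ _ fun l => by
    rw [row_dotProduct_inv_col hOm, if_neg (hb l).symm]

lemma memLp_dotProduct (a : Fin p → ℝ) : MemLp (fun x : EuclideanSpace ℝ (Fin p) => a ⬝ᵥ x.ofLp) 2
    (multivariateGaussian 0 Om⁻¹) :=
  (hasGaussianLaw_dotProduct a).memLp_two

lemma memLp_apply (j : Fin p) : MemLp (fun x : EuclideanSpace ℝ (Fin p) => x j) 2
    (multivariateGaussian 0 Om⁻¹) := by
  simpa only [single_one_dotProduct] using memLp_dotProduct (Om := Om) (Pi.single j 1)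

lemma integral_row_mul_sub_condExp (hOm : Om.PosDef) {K : Type*} [Finite K] {k : Fin p}
    {b : K → Fin p} (hb : ∀ l, b l ≠ k) (j : Fin p) :
    ∫ x : EuclideanSpace ℝ (Fin p), Om k ⬝ᵥ x.ofLp *
      (x j - ((multivariateGaussian 0 Om⁻¹)[fun x : EuclideanSpace ℝ (Fin p) => x j |
        MeasurableSpace.comap (fun (x : EuclideanSpace ℝ (Fin p)) l => x (b l)) inferInstance]) x)
      ∂multivariateGaussian 0 Om⁻¹ = if k = j then 1 else 0 := by
  set m := MeasurableSpace.comap (fun (x : EuclideanSpace ℝ (Fin p)) l => x (b l)) inferInstance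
  set γ := multivariateGaussian (0 : EuclideanSpace ℝ (Fin p)) Om⁻¹
  have hindep : IndepFun (fun x : EuclideanSpace ℝ (Fin p) => Om k ⬝ᵥ x.ofLp)
      (γ[fun x : EuclideanSpace ℝ (Fin p) => x j | m]) γ :=
    indep_of_indep_of_le_right (indepFun_row_apply hOm hb)
      stronglyMeasurable_condExp.measurable.comap_le
  rw [integral_mul_sub_condExp (memLp_dotProduct _) (memLp_apply j),
    integral_dotProduct_mul_apply hOm.inv.posSemidef, row_dotProduct_inv_col hOm,
    hindep.integral_fun_mul_eq_mul_integral
      (memLp_dotProduct (Om := Om) _).aestronglyMeasurable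
      ((memLp_apply j).condExp one_le_two).aestronglyMeasurable,
    integral_dotProduct, zero_mul, sub_zero]

lemma integral_dotProduct_mul {f : EuclideanSpace ℝ (Fin p) → ℝ}
    (hf : MemLp f 2 (multivariateGaussian 0 Om⁻¹)) {j : Fin p}
    (h : ∀ l ≠ j, ∫ x : EuclideanSpace ℝ (Fin p), x l * f x ∂multivariateGaussian 0 Om⁻¹ = 0)
    (a : Fin p → ℝ) :
    ∫ x : EuclideanSpace ℝ (Fin p), a ⬝ᵥ x.ofLp * f x ∂multivariateGaussian 0 Om⁻¹ =
      a j * ∫ x : EuclideanSpace ℝ (Fin p), x j * f x ∂multivariateGaussian 0 Om⁻¹ := by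
  simp only [dotProduct, Finset.sum_mul, mul_assoc]
  have hint (l) : Integrable (fun x : EuclideanSpace ℝ (Fin p) => a l * (x l * f x))
      (multivariateGaussian 0 Om⁻¹) := ((memLp_apply l).integrable_mul hf).const_mul (a l)
  rw [integral_finsetSum _ fun l _ => hint l]
  simp only [integral_const_mul]
  exact Finset.sum_eq_single_of_mem j (Finset.mem_univ j) fun l _ hl => by rw [h l hl, mul_zero]

/-- Let `w` be the residual of `x j` given the coordinates other than `i` and `j`. It is
uncorrelated with every `x l`, `l ≠ j`, by conditional independence for `l = i`; hence
`E[(Om k ⬝ x) w] = Om k j * E[x j * w]` for all `k`. The left-hand side is `0` for `k = i` and `1`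
for `k = j`. -/
theorem precision_eq_zero_of_not_isEdge (hOm : Om.PosDef) {i j : Fin p} (hij : i ≠ j)
    (h : ¬ IsEdge Om i j) : Om i j = 0 := by
  have hci := not_not.1 fun hdep => h ⟨hij, hdep⟩
  let b : {k : Fin p // k ≠ i ∧ k ≠ j} → Fin p := Subtype.val
  set m := MeasurableSpace.comap (fun (x : EuclideanSpace ℝ (Fin p)) l => x (b l)) inferInstance
    with hm_def
  have hm : m ≤ WithLp.measurableSpace 2 (Fin p → ℝ) := Measurable.comap_le (by fun_prop)
  set γ := multivariateGaussian (0 : EuclideanSpace ℝ (Fin p)) Om⁻¹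
  let w (x : EuclideanSpace ℝ (Fin p)) : ℝ :=
    x j - (γ[fun x : EuclideanSpace ℝ (Fin p) => x j | m]) x
  have huncorr (l) (hl : l ≠ j) : ∫ x : EuclideanSpace ℝ (Fin p), x l * w x ∂γ = 0 := by
    by_cases hli : l = i
    · subst hli
      exact integral_mul_sub_condExp_of_condIndepFun hci (by fun_prop) (by fun_prop)
        (memLp_apply l) (memLp_apply j)
    · refine integral_mul_sub_condExp_of_stronglyMeasurable hm
        (Measurable.stronglyMeasurable ?_) (memLp_apply l) (memLp_apply j)
      have hb : Measurable[m] fun (x : EuclideanSpace ℝ (Fin p)) l => x (b l) :=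
        comap_measurable _
      exact (measurable_pi_apply ⟨l, hli, hl⟩).comp hb
  have hw : MemLp w 2 γ := (memLp_apply j).sub ((memLp_apply j).condExp one_le_two)
  have hi := integral_dotProduct_mul hw huncorr (Om i)
  have hj := integral_dotProduct_mul hw huncorr (Om j)
  rw [integral_row_mul_sub_condExp hOm (fun l => l.2.1), if_neg hij] at hi
  rw [integral_row_mul_sub_condExp hOm (fun l => l.2.2), if_pos rfl] at hj
  exact (mul_eq_zero.1 hi.symm).resolve_right (right_ne_zero_of_mul_eq_one hj.symm)

end Precision

/-! ### The law of a Gaussian sample -/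

section IIDRows

variable {ι m m' : Type*}

lemma measurable_entry (k : m) (j : ι) : Measurable fun X : Matrix m ι ℝ => X k j :=
  (measurable_pi_apply j).comp (measurable_pi_apply (X := fun _ : m => ι → ℝ) k)

lemma measurable_of_entries {α : Type*} [MeasurableSpace α] {f : α → Matrix m ι ℝ}
    (h : ∀ k j, Measurable fun a => f a k j) : Measurable f :=
  measurable_pi_iff.2 fun k => measurable_pi_iff.2 fun j => h k j

/-- The law of a random matrix with i.i.d. rows, indexed by `m`, of law `ρ`. -/
noncomputable def iidRows (ρ : Measure (ι → ℝ)) (m : Type*) [Fintype m] : Measure (Matrix m ι ℝ) :=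
  Measure.pi fun _ => ρ

variable {ρ : Measure (ι → ℝ)} [IsProbabilityMeasure ρ] [Fintype m] [Fintype m']

instance isProbabilityMeasure_iidRows : IsProbabilityMeasure (iidRows ρ m) :=
  inferInstanceAs (IsProbabilityMeasure (Measure.pi fun _ : m => ρ))

lemma measurePreserving_submatrix {f : m' → m} (hf : f.Injective) :
    MeasurePreserving (fun X : Matrix m ι ℝ => X.submatrix f id) (iidRows ρ m) (iidRows ρ m') := by
  have hlaw (k : m) : (iidRows ρ m).map (fun X => X k) = ρ := (measurePreserving_eval _ k).map_eq
  have hindep : iIndepFun (fun (k : m) (X : Matrix m ι ℝ) => X k) (iidRows ρ m) :=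
    iIndepFun_pi (X := fun _ => id) fun _ => aemeasurable_id
  refine ⟨measurable_of_entries fun k j => measurable_entry (f k) j, ?_⟩
  refine ((hindep.precomp hf).map_fun_eq_pi_map fun k =>
    (measurable_pi_apply (X := fun _ : m => ι → ℝ) (f k)).aemeasurable).trans ?_
  exact congrArg Measure.pi (funext fun k => hlaw (f k))

end IIDRows

section RowLaw

variable {p : ℕ} {Om : Matrix (Fin p) (Fin p) ℝ} {i : Fin p}

/-- The law of a row of the data matrix: the centred Gaussian law with precision matrix `Om`. -/
noncomputable def rowLaw (Om : Matrix (Fin p) (Fin p) ℝ) : Measure (Fin p → ℝ) :=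
  (multivariateGaussian 0 Om⁻¹).map WithLp.ofLp

instance isProbabilityMeasure_rowLaw : IsProbabilityMeasure (rowLaw Om) :=
  Measure.isProbabilityMeasure_map (by fun_prop)

lemma IsGaussianSample.map_eq {Ω : Type*} [MeasurableSpace Ω] {μ : Measure Ω} {n : ℕ}
    {X : Ω → Matrix (Fin n) (Fin p) ℝ} (hX : IsGaussianSample μ Om X) :
    μ.map X = iidRows (rowLaw Om) (Fin n) := by
  have hrow (k) : Measurable fun ω => X ω k :=
    (measurable_pi_apply (X := fun _ : Fin n => Fin p → ℝ) k).comp hX.measurable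
  have hlaw (k) : μ.map (fun ω => X ω k) = rowLaw Om := by
    rw [rowLaw, ← hX.law k, Measure.map_map (by fun_prop) (by fun_prop)]
    rfl
  refine (hX.indep.map_fun_eq_pi_map fun k => (hrow k).aemeasurable).trans ?_
  simp only [hlaw]
  rfl

/-- The law of a row of the design in the regression of node `i`. -/
noncomputable def othersLaw (Om : Matrix (Fin p) (Fin p) ℝ) (i : Fin p) : Measure (Others i → ℝ) :=
  (rowLaw Om).map fun (x : Fin p → ℝ) (j : Others i) => x j

instance isProbabilityMeasure_othersLaw : IsProbabilityMeasure (othersLaw Om i) :=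
  Measure.isProbabilityMeasure_map (measurable_pi_iff.2 fun _ => measurable_pi_apply _).aemeasurable

/-- The coefficients of the regression of node `i` on the other nodes. -/
noncomputable def regCoef (Om : Matrix (Fin p) (Fin p) ℝ) (i : Fin p) : Others i → ℝ :=
  fun j => - (Om i i)⁻¹ * Om i j

/-- The observation of all nodes with regressors `z.1` and noise `z.2` at node `i`, when the
regression of node `i` has coefficients `β`. -/
def regRow (i : Fin p) (β : Others i → ℝ) (z : (Others i → ℝ) × ℝ) : Fin p → ℝ :=
  fun j => if h : j ≠ i then z.1 ⟨j, h⟩ else z.1 ⬝ᵥ β + z.2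

lemma measurable_regRow (β : Others i → ℝ) : Measurable (regRow i β) := by
  unfold regRow dotProduct
  refine measurable_pi_iff.2 fun j => ?_
  split_ifs <;> fun_prop

lemma sum_eq_add_sum_others {M : Type*} [AddCommMonoid M] (i : Fin p) (f : Fin p → M) :
    ∑ j, f j = f i + ∑ j : Others i, f j := by
  rw [← Finset.add_sum_erase _ f (Finset.mem_univ i)]
  exact congrArg _ (Finset.sum_subtype _ (fun j => by simp) f)

lemma regRow_regCoef (hi : Om i i ≠ 0) (x : Fin p → ℝ) :
    regRow i (regCoef Om i) (fun j => x j, (Om i i)⁻¹ * (Om i ⬝ᵥ x)) = x := by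
  have hres : (Om i i)⁻¹ * (Om i ⬝ᵥ x) = x i - (fun j : Others i => x j) ⬝ᵥ regCoef Om i := by
    simp only [dotProduct, sum_eq_add_sum_others i, regCoef, mul_add, inv_mul_cancel_left₀ hi,
      Finset.mul_sum, sub_eq_add_neg, ← Finset.sum_neg_distrib]
    exact congrArg _ (Finset.sum_congr rfl fun j _ => by ring)
  funext j
  unfold regRow
  split_ifs with hj
  · rfl
  · rw [hres, not_not.1 hj, add_sub_cancel]

lemma exists_measurePreserving_regRow (hOm : Om.PosDef) (i : Fin p) :
    ∃ v, MeasurePreserving (regRow i (regCoef Om i)) ((othersLaw Om i).prod (gaussianReal 0 v))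
      (rowLaw Om) := by
  let e (x : EuclideanSpace ℝ (Fin p)) : ℝ := (Om i i)⁻¹ * (Om i ⬝ᵥ x.ofLp)
  have he : e = fun x => ((Om i i)⁻¹ • Om i) ⬝ᵥ x.ofLp := by
    simp only [e, smul_dotProduct, smul_eq_mul]
  have hgauss : HasGaussianLaw e (multivariateGaussian 0 Om⁻¹) :=
    he ▸ hasGaussianLaw_dotProduct _
  have hmean : ∫ x, e x ∂multivariateGaussian 0 Om⁻¹ = 0 := he ▸ integral_dotProduct _
  have hem : Measurable e := by unfold e dotProduct; fun_prop
  have hothers : Measurable fun (x : EuclideanSpace ℝ (Fin p)) (j : Others i) => x j := by fun_prop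
  have hindep : IndepFun (fun (x : EuclideanSpace ℝ (Fin p)) (j : Others i) => x j) e
      (multivariateGaussian 0 Om⁻¹) :=
    ((indepFun_row_apply hOm Subtype.prop).comp (measurable_const_mul _) measurable_id).symm
  have hprod := (indepFun_iff_map_prod_eq_prod_map_map hothers.aemeasurable hem.aemeasurable).1
    hindep
  rw [hgauss.map_eq_gaussianReal, hmean] at hprod
  refine ⟨Var[e; multivariateGaussian 0 Om⁻¹].toNNReal, measurable_regRow _, ?_⟩
  unfold othersLaw rowLaw
  rw [Measure.map_map (by fun_prop) (by fun_prop)]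
  refine (congrArg _ hprod.symm).trans ?_
  rw [Measure.map_map (measurable_regRow _) (hothers.prodMk hem)]
  exact congrArg₂ _ (funext fun x => regRow_regCoef hOm.diag_pos.ne' x.ofLp) rfl

/-- The data matrix with design `z.1` and noise `z.2` in the regression of node `i`, when the
coefficients are `β`. -/
def regMatrix {m : Type*} (i : Fin p) (β : Others i → ℝ) (z : Matrix m (Others i) ℝ × (m → ℝ)) :
    Matrix m (Fin p) ℝ :=
  Matrix.of fun k => regRow i β (z.1 k, z.2 k)

lemma exists_measurePreserving_regMatrix (hOm : Om.PosDef) (i : Fin p) (m : Type*) [Fintype m] :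
    ∃ v, MeasurePreserving (regMatrix i (regCoef Om i))
      ((iidRows (othersLaw Om i) m).prod (Measure.pi fun _ : m => gaussianReal 0 v))
      (iidRows (rowLaw Om) m) := by
  obtain ⟨v, hv⟩ := exists_measurePreserving_regRow hOm i
  exact ⟨v, (measurePreserving_pi _ _ fun _ : m => hv).comp
    (measurePreserving_arrowProdEquivProdArrow _ _ m (fun _ => othersLaw Om i)
      fun _ => gaussianReal 0 v).symm⟩

end RowLaw

/-! ### Gaussian designs have full column rank -/

lemma isUnit_det_gram_iff {m ι : Type*} [Fintype m] [Fintype ι] [DecidableEq ι]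
    {A : Matrix m ι ℝ} :
    IsUnit (A.transpose * A).det ↔ Function.Injective A.mulVec := by
  rw [← Matrix.isUnit_iff_isUnit_det, ← Matrix.mulVec_injective_iff_isUnit,
    ← Matrix.coe_mulVecLin, ← Matrix.coe_mulVecLin, ← LinearMap.ker_eq_bot,
    ← LinearMap.ker_eq_bot, Matrix.ker_mulVecLin_transpose_mul_self]

lemma ae_linearIndependent {E : Type*} [NormedAddCommGroup E] [NormedSpace ℝ E]
    [FiniteDimensional ℝ E] [MeasurableSpace E] [BorelSpace E] {ρ : Measure E} [SigmaFinite ρ]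
    (hρ : ∀ V : Submodule ℝ E, V < ⊤ → ∀ᵐ x ∂ρ, x ∉ V) {k : ℕ} (hk : k ≤ Module.finrank ℝ E) :
    ∀ᵐ v ∂Measure.pi fun _ : Fin k => ρ, LinearIndependent ℝ v := by
  induction k with
  | zero => exact ae_of_all _ fun v => linearIndependent_empty_type
  | succ k ih =>
    have hcons := (measurePreserving_piFinSuccAbove (fun _ : Fin (k + 1) => ρ) 0).symm
    have hindep : MeasurableSet {v : Fin (k + 1) → E | LinearIndependent ℝ v} :=
      isOpen_setOfPred_linearIndependent.measurableSet
    have hpre := hcons.measurable hindep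
    rw [← hcons.map_eq]
    refine (ae_map_iff hcons.measurable.aemeasurable hindep).2
      ((Measure.ae_prod_iff_ae_ae hpre).2 ((Measure.ae_ae_comm (p := fun x v =>
        LinearIndependent ℝ (Fin.insertNth (0 : Fin (k + 1)) x v : Fin (k + 1) → E)) hpre).2 ?_))
    filter_upwards [ih (by omega)] with v hv
    have hspan : Submodule.span ℝ (Set.range v) < ⊤ := by
      refine lt_top_iff_ne_top.2 fun htop => ?_
      have hdim := finrank_span_eq_card hv
      rw [htop, finrank_top, Fintype.card_fin] at hdim
      omega
    filter_upwards [hρ _ hspan] with x hx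
    rw [Fin.insertNth_zero']
    exact linearIndependent_finCons.2 ⟨hv, hx⟩

lemma nodeDesign_mulVec_injective {m p : ℕ} {X : Matrix (Fin m) (Fin p) ℝ}
    (hX : Function.Injective X.mulVec) (i : Fin p) :
    Function.Injective (nodeDesign X i).mulVec := by
  have hextend (b : Others i → ℝ) : (nodeDesign X i).mulVec b =
      X.mulVec (Function.extend Subtype.val b 0) := by
    funext k
    simp only [Matrix.mulVec, dotProduct, sum_eq_add_sum_others i]
    rw [Function.extend_apply' _ _ _ fun ⟨j, hj⟩ => j.2 hj, Pi.zero_apply, mul_zero, zero_add]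
    simp only [Subtype.val_injective.extend_apply]
    rfl
  intro b b' h
  rw [hextend, hextend] at h
  exact Function.extend_injective Subtype.val_injective _ (hX h)

section

variable {p : ℕ} {Om : Matrix (Fin p) (Fin p) ℝ}

lemma ae_dotProduct_ne_zero (hOm : Om.PosDef) {c : Fin p → ℝ} (hc : c ≠ 0) :
    ∀ᵐ x ∂rowLaw Om, c ⬝ᵥ x ≠ 0 := by
  let f : EuclideanSpace ℝ (Fin p) → ℝ := fun x => c ⬝ᵥ x.ofLp
  have hf : Measurable f := by unfold f dotProduct; fun_prop
  have hvar : 0 < Var[f; multivariateGaussian 0 Om⁻¹] := by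
    rw [← covariance_self hf.aemeasurable, covariance_dotProduct hOm.inv.posSemidef]
    exact hOm.inv.dotProduct_mulVec_pos hc
  have hnull : ∀ᵐ y ∂(multivariateGaussian 0 Om⁻¹).map f, y ≠ 0 := by
    rw [(hasGaussianLaw_dotProduct c).map_eq_gaussianReal, integral_dotProduct]
    have := nullSingletonClass_gaussianReal (μ := 0) (Real.toNNReal_pos.2 hvar).ne'
    exact Measure.ae_ne _ 0
  have hne : MeasurableSet {x : Fin p → ℝ | c ⬝ᵥ x ≠ 0} :=
    (measurableSet_singleton 0).compl.preimage (by unfold dotProduct; fun_prop)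
  exact (ae_map_iff (by fun_prop) hne).2 (ae_of_ae_map hf.aemeasurable hnull)

lemma ae_notMem_submodule (hOm : Om.PosDef) {V : Submodule ℝ (Fin p → ℝ)} (hV : V < ⊤) :
    ∀ᵐ x ∂rowLaw Om, x ∉ V := by
  obtain ⟨φ, hφ, hker⟩ := V.exists_le_ker_of_lt_top hV
  obtain ⟨c, rfl⟩ := (dotProductEquiv ℝ (Fin p)).surjective φ
  have hc : c ≠ 0 := fun h => hφ (by rw [h, map_zero])
  filter_upwards [ae_dotProduct_ne_zero hOm hc] with x hx hxV
  exact hx (hker hxV)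

lemma ae_mulVec_injective (hOm : Om.PosDef) {m : ℕ} (hm : p ≤ m) :
    ∀ᵐ X ∂iidRows (rowLaw Om) (Fin m), Function.Injective X.mulVec := by
  have hsub := measurePreserving_submatrix (ρ := rowLaw Om) (Fin.castLE_injective hm)
  have hrows : ∀ᵐ B ∂iidRows (rowLaw Om) (Fin p), LinearIndependent ℝ B.row :=
    ae_linearIndependent (fun _ => ae_notMem_submodule hOm) (Module.finrank_fin_fun ℝ).ge
  filter_upwards [hsub.quasiMeasurePreserving.ae hrows] with X hX x y hxy
  refine Matrix.mulVec_injective_iff_isUnit.2 (Matrix.linearIndependent_rows_iff_isUnit.1 hX) ?_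
  exact funext fun k => congrFun hxy (Fin.castLE hm k)

end

/-! ### Joining two blocks of rows -/

section JoinRows

variable {a b m ι : Type*}

/-- The matrix with rows `A` and `B`, placed at the row indices given by `e`. -/
def joinRows (e : a ⊕ b ≃ m) (A : Matrix a ι ℝ) (B : Matrix b ι ℝ) : Matrix m ι ℝ :=
  (Matrix.fromRows A B).submatrix e.symm id

lemma joinRows_inl (e : a ⊕ b ≃ m) (A : Matrix a ι ℝ) (B : Matrix b ι ℝ) (k : a) :
    joinRows e A B (e (.inl k)) = A k := by
  funext j
  simp [joinRows]

lemma joinRows_inr (e : a ⊕ b ≃ m) (A : Matrix a ι ℝ) (B : Matrix b ι ℝ) (k : b) :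
    joinRows e A B (e (.inr k)) = B k := by
  funext j
  simp [joinRows]

lemma eq_joinRows_iff {e : a ⊕ b ≃ m} {X : Matrix m ι ℝ} {A : Matrix a ι ℝ} {B : Matrix b ι ℝ} :
    X = joinRows e A B ↔ (∀ k, X (e (.inl k)) = A k) ∧ ∀ k, X (e (.inr k)) = B k := by
  refine ⟨?_, fun ⟨hl, hr⟩ => ?_⟩
  · rintro rfl
    exact ⟨joinRows_inl e A B, joinRows_inr e A B⟩
  · ext k : 1
    obtain ⟨k | k, rfl⟩ := e.surjective k
    · rw [hl, joinRows_inl]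
    · rw [hr, joinRows_inr]

lemma measurable_joinRows (e : a ⊕ b ≃ m) :
    Measurable fun z : Matrix a ι ℝ × Matrix b ι ℝ => joinRows e z.1 z.2 := by
  refine measurable_of_entries fun k j => ?_
  obtain ⟨k | k, rfl⟩ := e.surjective k
  · simp only [joinRows_inl]
    exact (measurable_entry k j).comp measurable_fst
  · simp only [joinRows_inr]
    exact (measurable_entry k j).comp measurable_snd

lemma swapCols_joinRows [DecidableEq ι] (e : a ⊕ b ≃ m) (H : Finset ι) (C Ct : Matrix a ι ℝ)
    (D Dt : Matrix b ι ℝ) : swapCols H (joinRows e C D) (joinRows e Ct Dt) =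
      joinRows e (swapCols H C Ct) (swapCols H D Dt) :=
  eq_joinRows_iff.2 ⟨fun k => by funext j; simp [swapCols, joinRows_inl],
    fun k => by funext j; simp [swapCols, joinRows_inr]⟩

lemma fromCols_joinRows {κ : Type*} (e : a ⊕ b ≃ m) (C : Matrix a ι ℝ) (Ct : Matrix a κ ℝ)
    (D : Matrix b ι ℝ) (Dt : Matrix b κ ℝ) : Matrix.fromCols (joinRows e C D) (joinRows e Ct Dt) =
      joinRows e (Matrix.fromCols C Ct) (Matrix.fromCols D Dt) :=
  eq_joinRows_iff.2 ⟨fun k => by ext (j | j) <;> simp [joinRows_inl],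
    fun k => by ext (j | j) <;> simp [joinRows_inr]⟩

lemma joinRows_mulVec_injective [Fintype ι] (e : a ⊕ b ≃ m) (C : Matrix a ι ℝ) {D : Matrix b ι ℝ}
    (hD : Function.Injective D.mulVec) : Function.Injective (joinRows e C D).mulVec := by
  refine fun x y hxy => hD (funext fun k => ?_)
  simpa only [Matrix.mulVec, joinRows_inr] using congrFun hxy (e (.inr k))

variable [Fintype b] [Fintype m]

lemma transpose_joinRows_mul_joinRows [Fintype a] {κ : Type*} (e : a ⊕ b ≃ m) (C : Matrix a ι ℝ)
    (Ct : Matrix a κ ℝ) (D : Matrix b ι ℝ) (Dt : Matrix b κ ℝ) :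
    (joinRows e C D).transpose * joinRows e Ct Dt = C.transpose * Ct + D.transpose * Dt := by
  rw [joinRows, joinRows, Matrix.transpose_submatrix, Matrix.submatrix_mul_equiv,
    Matrix.submatrix_id_id, Matrix.transpose_fromRows, Matrix.fromCols_mul_fromRows]

lemma transpose_joinRows_mulVec [Fintype a] (e : a ⊕ b ≃ m) (C : Matrix a ι ℝ) (D : Matrix b ι ℝ)
    (y : m → ℝ) : (joinRows e C D).transpose.mulVec y =
      C.transpose.mulVec (y ∘ e ∘ Sum.inl) + D.transpose.mulVec (y ∘ e ∘ Sum.inr) := by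
  rw [joinRows, Matrix.transpose_submatrix, Matrix.submatrix_mulVec_equiv,
    Matrix.transpose_fromRows, Matrix.fromCols_mulVec]
  rfl

variable [Finite a] [DecidableEq ι] {D Dt : Matrix b ι ℝ}

lemma isKnockoff_joinRows (h : IsKnockoff D Dt) (e : a ⊕ b ≃ m) (C : Matrix a ι ℝ) :
    IsKnockoff (joinRows e C D) (joinRows e C Dt) := by
  have := Fintype.ofFinite a
  obtain ⟨s, hs, hDDt, hDtD, hDt⟩ := h
  exact ⟨s, hs, by simp only [transpose_joinRows_mul_joinRows, hDDt, add_sub_assoc],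
    by simp only [transpose_joinRows_mul_joinRows, hDtD, add_sub_assoc],
    by simp only [transpose_joinRows_mul_joinRows, hDt]⟩

lemma IsKnockoff.mulVec_joinRows_reflectAlong (h : IsKnockoff D Dt) (e : a ⊕ b ≃ m)
    (C : Matrix a ι ℝ) (j : ι) {y y' : m → ℝ} (hl : y' ∘ e ∘ Sum.inl = y ∘ e ∘ Sum.inl)
    (hr : y' ∘ e ∘ Sum.inr = reflectAlong (D.col j - Dt.col j) (y ∘ e ∘ Sum.inr)) :
    (Matrix.fromCols (joinRows e C D) (joinRows e C Dt)).transpose.mulVec y' =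
      (Matrix.fromCols (swapCols {j} (joinRows e C D) (joinRows e C Dt))
        (swapCols {j} (joinRows e C Dt) (joinRows e C D))).transpose.mulVec y := by
  have := Fintype.ofFinite a
  have hswap : swapCols {j} C C = C := by ext k l; simp [swapCols]
  simp only [swapCols_joinRows, fromCols_joinRows, transpose_joinRows_mulVec, hl, hr,
    h.mulVec_reflectAlong, hswap]

end JoinRows

lemma measurePreserving_submatrix_inl_inr {a b m ι : Type*} [Fintype a] [Fintype b] [Fintype m]
    {ρ : Measure (ι → ℝ)} [IsProbabilityMeasure ρ] (e : a ⊕ b ≃ m) :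
    MeasurePreserving (fun X : Matrix m ι ℝ =>
        (X.submatrix (e ∘ Sum.inl) id, X.submatrix (e ∘ Sum.inr) id))
      (iidRows ρ m) ((iidRows ρ a).prod (iidRows ρ b)) :=
  (measurePreserving_sumPiEquivProdPi fun _ : a ⊕ b => ρ).comp
    (measurePreserving_submatrix (ρ := ρ) e.injective)

/-! ### Recycled knockoffs -/

section Halves

variable {n p : ℕ}

/-- The rows of the first and of the second half. -/
def splitEquiv (n : ℕ) : Fin (n / 2) ⊕ Fin (n - n / 2) ≃ Fin n :=
  finSumFinEquiv.trans (finCongr (by omega))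

lemma joinRows_firstHalf_secondHalf (X : Matrix (Fin n) (Fin p) ℝ) :
    joinRows (splitEquiv n) (firstHalf X) (secondHalf X) = X :=
  (eq_joinRows_iff.2 ⟨fun _ => rfl, fun _ => rfl⟩).symm

lemma firstHalf_joinRows (A : Matrix (Fin (n / 2)) (Fin p) ℝ)
    (B : Matrix (Fin (n - n / 2)) (Fin p) ℝ) : firstHalf (joinRows (splitEquiv n) A B) = A :=
  funext fun k => joinRows_inl (splitEquiv n) A B k

lemma secondHalf_joinRows (A : Matrix (Fin (n / 2)) (Fin p) ℝ)
    (B : Matrix (Fin (n - n / 2)) (Fin p) ℝ) : secondHalf (joinRows (splitEquiv n) A B) = B :=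
  funext fun k => joinRows_inr (splitEquiv n) A B k

lemma measurePreserving_halves {ρ : Measure (Fin p → ℝ)} [IsProbabilityMeasure ρ] (n : ℕ) :
    MeasurePreserving (fun X => (firstHalf X, secondHalf X)) (iidRows ρ (Fin n))
      ((iidRows ρ (Fin (n / 2))).prod (iidRows ρ (Fin (n - n / 2)))) :=
  measurePreserving_submatrix_inl_inr (splitEquiv n)

lemma measurable_firstHalf :
    Measurable (firstHalf : Matrix (Fin n) (Fin p) ℝ → Matrix (Fin (n / 2)) (Fin p) ℝ) :=
  measurable_of_entries fun _ j => measurable_entry _ j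

lemma measurable_secondHalf :
    Measurable (secondHalf : Matrix (Fin n) (Fin p) ℝ → Matrix (Fin (n - n / 2)) (Fin p) ℝ) :=
  measurable_of_entries fun _ j => measurable_entry _ j

lemma measurable_nodeDesign (i : Fin p) :
    Measurable fun X : Matrix (Fin n) (Fin p) ℝ => nodeDesign X i :=
  measurable_of_entries fun k j => measurable_entry k j.1

lemma nodeDesign_eq_joinRows (X : Matrix (Fin n) (Fin p) ℝ) (i : Fin p) :
    nodeDesign X i =
      joinRows (splitEquiv n) (nodeDesign (firstHalf X) i) (nodeDesign (secondHalf X) i) :=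
  eq_joinRows_iff.2 ⟨fun _ => rfl, fun _ => rfl⟩

lemma recycledKnockoff_eq_joinRows (K : KnockoffRule p) (X : Matrix (Fin n) (Fin p) ℝ)
    (i : Fin p) : recycledKnockoff K X i =
      joinRows (splitEquiv n) (nodeDesign (firstHalf X) i)
        (K (n - n / 2) i (nodeDesign (secondHalf X) i)) := by
  refine eq_joinRows_iff.2 ⟨fun k => ?_, fun k => ?_⟩ <;> funext j
  · exact dif_pos k.2
  · refine (dif_neg (Nat.not_lt.2 (Nat.le_add_right _ _))).trans ?_
    exact congrFun (congrArg _ (Fin.ext (Nat.add_sub_cancel_left ..))) j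

/-- What the error control uses of a knockoff construction: it is measurable, and it yields
knockoffs of every design of full column rank with at least twice as many rows as columns. -/
structure MakesKnockoffs (K : KnockoffRule p) : Prop where
  measurable : ∀ n i, Measurable (K n i)
  isKnockoff : ∀ (n : ℕ) (i : Fin p) (X : Matrix (Fin n) (Others i) ℝ),
    2 * Fintype.card (Others i) ≤ n → IsUnit (X.transpose * X).det → IsKnockoff X (K n i X)

lemma IsKnockoffRule.makesKnockoffs {std : Bool} {o : OptStrategy} {K : KnockoffRule p}
    (hK : IsKnockoffRule std o K) : MakesKnockoffs K :=
  ⟨hK.measurable, fun _ i _ => hK.isKnockoff i⟩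

variable {K : KnockoffRule p} {X : Matrix (Fin n) (Fin p) ℝ} {i : Fin p}

lemma MakesKnockoffs.measurable_recycledKnockoff (hK : MakesKnockoffs K) (n : ℕ) (i : Fin p) :
    Measurable fun X : Matrix (Fin n) (Fin p) ℝ => recycledKnockoff K X i := by
  simp only [recycledKnockoff_eq_joinRows]
  exact (measurable_joinRows (splitEquiv n)).comp
    (((measurable_nodeDesign i).comp measurable_firstHalf).prodMk
      ((hK.measurable _ i).comp ((measurable_nodeDesign i).comp measurable_secondHalf)))

lemma MakesKnockoffs.isKnockoff_of_four_mul_le (hK : MakesKnockoffs K) (hnp : 4 * p ≤ n)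
    {D : Matrix (Fin (n - n / 2)) (Others i) ℝ} (hD : Function.Injective D.mulVec) :
    IsKnockoff D (K (n - n / 2) i D) := by
  refine hK.isKnockoff _ i D ?_ (isUnit_det_gram_iff.2 hD)
  have hcard : Fintype.card (Others i) ≤ p :=
    (Fintype.card_subtype_le _).trans_eq (Fintype.card_fin p)
  omega

lemma isUnit_det_gram_nodeDesign (hX : Function.Injective (nodeDesign (secondHalf X) i).mulVec) :
    IsUnit ((nodeDesign X i).transpose * nodeDesign X i).det := by
  rw [isUnit_det_gram_iff, nodeDesign_eq_joinRows]
  exact joinRows_mulVec_injective _ _ hX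

lemma MakesKnockoffs.isKnockoff_recycledKnockoff (hK : MakesKnockoffs K) (hnp : 4 * p ≤ n)
    (hX : Function.Injective (nodeDesign (secondHalf X) i).mulVec) :
    IsKnockoff (nodeDesign X i) (recycledKnockoff K X i) := by
  rw [nodeDesign_eq_joinRows, recycledKnockoff_eq_joinRows]
  exact isKnockoff_joinRows (hK.isKnockoff_of_four_mul_le hnp hX) _ _

end Halves

/-! ### Statistics from recycled knockoffs -/

lemma measurable_gram_fromCols {α m ι κ : Type*} [MeasurableSpace α] [Fintype m]
    {A : α → Matrix m ι ℝ} {B : α → Matrix m κ ℝ} {y : α → m → ℝ} (hA : Measurable A)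
    (hB : Measurable B) (hy : Measurable y) :
    Measurable fun x => ((Matrix.fromCols (A x) (B x)).transpose * Matrix.fromCols (A x) (B x),
      (Matrix.fromCols (A x) (B x)).transpose.mulVec (y x)) := by
  have hAB (k : m) (l : ι ⊕ κ) : Measurable fun x => Matrix.fromCols (A x) (B x) k l := by
    rcases l with l | l
    · exact (measurable_entry k l).comp hA
    · exact (measurable_entry k l).comp hB
  refine Measurable.prodMk (measurable_of_entries fun k l => ?_) (measurable_pi_iff.2 fun k => ?_)
  · simp only [Matrix.mul_apply, Matrix.transpose_apply]
    exact Finset.measurable_sum _ fun r _ => (hAB r k).mul (hAB r l)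
  · simp only [Matrix.mulVec, dotProduct, Matrix.transpose_apply]
    exact Finset.measurable_sum _ fun r _ => (hAB r k).mul ((measurable_pi_apply r).comp hy)

lemma measurableSet_mulVec_injective {m ι : Type*} [Finite m] [Fintype ι] :
    MeasurableSet {A : Matrix m ι ℝ | Function.Injective A.mulVec} := by
  classical
  have := Fintype.ofFinite m
  simp only [← isUnit_det_gram_iff, isUnit_iff_ne_zero]
  have hdet : Continuous fun A : Matrix m ι ℝ => (A.transpose * A).det := by fun_prop
  exact IsOpen.measurableSet (α := m → ι → ℝ) (isOpen_ne.preimage hdet)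

section RecycledStat

variable {n p : ℕ} {K : KnockoffRule p} {P : FeatureProcedure p} {i : Fin p}

open Classical in
/-- The statistics of node `i` from the data `Y` with recycled knockoffs. They are set to `0` if the
second half of the design is rank deficient: there the construction is not specified, and the
statistics of the procedure need not be measurable. -/
noncomputable def recycledStat (K : KnockoffRule p) (P : FeatureProcedure p) (i : Fin p)
    (Y : Matrix (Fin n) (Fin p) ℝ) : Fin p → ℝ :=
  if Function.Injective (nodeDesign (secondHalf Y) i).mulVec then
    statMatrix P Y (recycledKnockoff K Y) i
  else 0

lemma recycledStat_of_injective {Y : Matrix (Fin n) (Fin p) ℝ}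
    (hY : Function.Injective (nodeDesign (secondHalf Y) i).mulVec) :
    recycledStat K P i Y = statMatrix P Y (recycledKnockoff K Y) i :=
  if_pos hY

lemma recycledStat_of_not_injective {Y : Matrix (Fin n) (Fin p) ℝ}
    (hY : ¬ Function.Injective (nodeDesign (secondHalf Y) i).mulVec) : recycledStat K P i Y = 0 :=
  if_neg hY

lemma measurable_recycledStat (hK : MakesKnockoffs K) (hnp : 4 * p ≤ n) (hs : HasSufficiency P)
    (i : Fin p) : Measurable fun Y : Matrix (Fin n) (Fin p) ℝ => recycledStat K P i Y := by
  classical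
  obtain ⟨f, hf, hPf⟩ := hs n i
  have hdesign : Measurable fun Y : Matrix (Fin n) (Fin p) ℝ => nodeDesign (secondHalf Y) i :=
    (measurable_nodeDesign i).comp measurable_secondHalf
  have hrank : MeasurableSet {Y : Matrix (Fin n) (Fin p) ℝ |
      Function.Injective (nodeDesign (secondHalf Y) i).mulVec} :=
    hdesign measurableSet_mulVec_injective
  have heq : (fun Y : Matrix (Fin n) (Fin p) ℝ => recycledStat K P i Y) = fun Y =>
      if Function.Injective (nodeDesign (secondHalf Y) i).mulVec then fun j =>
        if h : j ≠ i then
          f ((Matrix.fromCols (nodeDesign Y i) (recycledKnockoff K Y i)).transpose *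
              Matrix.fromCols (nodeDesign Y i) (recycledKnockoff K Y i),
            (Matrix.fromCols (nodeDesign Y i) (recycledKnockoff K Y i)).transpose.mulVec
              fun k => Y k i) ⟨j, h⟩
        else 0
      else 0 := by
    funext Y
    refine if_ctx_congr Iff.rfl
      (fun hY => funext fun j => dite_congr rfl (fun h => ?_) fun _ => rfl) fun _ => rfl
    rw [hPf _ _ _ (isUnit_det_gram_nodeDesign hY) (hK.isKnockoff_recycledKnockoff hnp hY)]
  rw [heq]
  refine Measurable.ite hrank (measurable_pi_iff.2 fun j => ?_) measurable_const
  split_ifs with h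
  · exact (measurable_pi_apply _).comp (hf.comp (measurable_gram_fromCols
      (measurable_nodeDesign i) (hK.measurable_recycledKnockoff n i)
      (measurable_pi_iff.2 fun k => measurable_entry k i)))
  · exact measurable_const

lemma nodeDesign_regMatrix {m : ℕ} (β : Others i → ℝ)
    (z : Matrix (Fin m) (Others i) ℝ × (Fin m → ℝ)) : nodeDesign (regMatrix i β z) i = z.1 := by
  ext k j
  simp [nodeDesign, regMatrix, regRow, j.2]

lemma recycledStat_eq_flipOn (hK : MakesKnockoffs K) (hnp : 4 * p ≤ n) (hs : HasSufficiency P)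
    (ha : HasAntisymmetry P) {Y Y' : Matrix (Fin n) (Fin p) ℝ}
    {D : Matrix (Fin (n - n / 2)) (Others i) ℝ} (hD : nodeDesign (secondHalf Y) i = D)
    (hYY' : nodeDesign Y' i = nodeDesign Y i) (j : Others i)
    (hfirst : (fun k => firstHalf Y' k i) = fun k => firstHalf Y k i)
    (hsecond : (fun k => secondHalf Y' k i) =
      reflectAlong (D.col j - (K (n - n / 2) i D).col j) fun k => secondHalf Y k i) :
    recycledStat K P i Y' = flipOn {j.1} (recycledStat K P i Y) := by
  subst hD
  have hsecondDesign : nodeDesign (secondHalf Y') i = nodeDesign (secondHalf Y) i :=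
    congrArg (fun A => A.submatrix (splitEquiv n ∘ Sum.inr) id) hYY'
  have hknockoff : recycledKnockoff K Y' i = recycledKnockoff K Y i := by
    rw [recycledKnockoff_eq_joinRows, recycledKnockoff_eq_joinRows, hsecondDesign]
    exact congrArg (fun A => joinRows (splitEquiv n) (A.submatrix (splitEquiv n ∘ Sum.inl) id) _)
      hYY'
  by_cases hinj : Function.Injective (nodeDesign (secondHalf Y) i).mulVec
  swap
  · rw [recycledStat_of_not_injective hinj,
      recycledStat_of_not_injective (hsecondDesign ▸ hinj), flipOn_zero]
  rw [recycledStat_of_injective hinj, recycledStat_of_injective (hsecondDesign ▸ hinj)]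
  have hflip := (hK.isKnockoff_of_four_mul_le hnp hinj).mulVec_joinRows_reflectAlong (splitEquiv n)
    (nodeDesign (firstHalf Y) i) j (y := fun k => Y k i) (y' := fun k => Y' k i) hfirst hsecond
  rw [← nodeDesign_eq_joinRows, ← recycledKnockoff_eq_joinRows] at hflip
  funext l
  simp only [statMatrix, hYY', hknockoff, flipOn, Finset.piecewise, Pi.neg_apply]
  by_cases hl : l ≠ i
  · rw [dif_pos hl, dif_pos hl, ha.apply_eq_of_mulVec_eq hs (isUnit_det_gram_nodeDesign hinj)
      (hK.isKnockoff_recycledKnockoff hnp hinj) {j} hflip]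
    simp only [Finset.mem_singleton, Subtype.ext_iff]
  · simp [dif_neg hl]

lemma recycledStat_reflectAlong (hK : MakesKnockoffs K) (hnp : 4 * p ≤ n) (hs : HasSufficiency P)
    (ha : HasAntisymmetry P) (X₁ : Matrix (Fin (n / 2)) (Fin p) ℝ)
    (D : Matrix (Fin (n - n / 2)) (Others i) ℝ) {β : Others i → ℝ} {j : Others i} (hβ : β j = 0)
    (ε : Fin (n - n / 2) → ℝ) :
    recycledStat K P i (joinRows (splitEquiv n) X₁ (regMatrix i β
        (D, reflectAlong (D.col j - (K (n - n / 2) i D).col j) ε))) =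
      flipOn {j.1} (recycledStat K P i (joinRows (splitEquiv n) X₁ (regMatrix i β (D, ε)))) := by
  have hresponse (ε) : (fun k => regMatrix i β (D, ε) k i) = D.mulVec β + ε := by
    funext k
    simp [regMatrix, regRow, Matrix.mulVec]
  have hdesign (ε) : nodeDesign (joinRows (splitEquiv n) X₁ (regMatrix i β (D, ε))) i =
      joinRows (splitEquiv n) (nodeDesign X₁ i) D := by
    rw [nodeDesign_eq_joinRows, firstHalf_joinRows, secondHalf_joinRows, nodeDesign_regMatrix]
  by_cases hD : Function.Injective D.mulVec
  · refine recycledStat_eq_flipOn hK hnp hs ha (by rw [secondHalf_joinRows, nodeDesign_regMatrix])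
      ((hdesign _).trans (hdesign _).symm) j (by rw [firstHalf_joinRows, firstHalf_joinRows]) ?_
    rw [secondHalf_joinRows, secondHalf_joinRows, hresponse, hresponse, map_add,
      (hK.isKnockoff_of_four_mul_le hnp hD).reflectAlong_mulVec hβ]
  · have hinj (ε) : ¬ Function.Injective (nodeDesign (secondHalf
        (joinRows (splitEquiv n) X₁ (regMatrix i β (D, ε)))) i).mulVec := by
      rwa [secondHalf_joinRows, nodeDesign_regMatrix]
    rw [recycledStat_of_not_injective (hinj _), recycledStat_of_not_injective (hinj _),
      flipOn_zero]

open Classical in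
/-- The nodes other than `i` that have coefficient zero in the regression of node `i`. -/
noncomputable def nullSet (Om : Matrix (Fin p) (Fin p) ℝ) (i : Fin p) : Finset (Fin p) :=
  Finset.univ.filter fun k => k ≠ i ∧ Om i k = 0

variable {Om : Matrix (Fin p) (Fin p) ℝ} {a c : ℝ}

lemma lintegral_maxRatio_recycledStat_le (hK : MakesKnockoffs K) (hnp : 4 * p ≤ n) (hOm : Om.PosDef)
    (hs : HasSufficiency P) (ha : HasAntisymmetry P) (hac : IsMaxRatioBound a c)
    (X₁ : Matrix (Fin (n / 2)) (Fin p) ℝ) (i : Fin p) :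
    ∫⁻ X₂, maxRatio a (nullSet Om i) (recycledStat K P i (joinRows (splitEquiv n) X₁ X₂))
      ∂iidRows (rowLaw Om) (Fin (n - n / 2)) ≤ ENNReal.ofReal c := by
  obtain ⟨v, hv⟩ := exists_measurePreserving_regMatrix hOm i (Fin (n - n / 2))
  have hstat : Measurable fun X₂ => recycledStat K P i (joinRows (splitEquiv n) X₁ X₂) :=
    (measurable_recycledStat hK hnp hs i).comp
      ((measurable_joinRows (splitEquiv n)).comp measurable_prodMk_left)
  have hratio := measurable_maxRatio a (nullSet Om i) hstat
  rw [← hv.lintegral_comp hratio]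
  refine (lintegral_prod _ (hratio.comp hv.measurable).aemeasurable).trans_le ?_
  refine lintegral_le_const (ae_of_all _ fun D => hac.lintegral_maxRatio_le
    (w := fun ε => recycledStat K P i (joinRows (splitEquiv n) X₁ (regMatrix i _ (D, ε))))
    (hstat.comp (hv.measurable.comp measurable_prodMk_left)) _ fun j hj => ?_)
  obtain ⟨hji, hOmj⟩ := (Finset.mem_filter.1 hj).2
  have hcoef : regCoef Om i ⟨j, hji⟩ = 0 := by simp [regCoef, hOmj]
  exact ⟨_, measurePreserving_reflectAlong v _, recycledStat_reflectAlong hK hnp hs ha X₁ D hcoef⟩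

lemma lintegral_sum_maxRatio_recycledStat_le (hK : MakesKnockoffs K) (hnp : 4 * p ≤ n)
    (hOm : Om.PosDef) (hs : HasSufficiency P) (ha : HasAntisymmetry P) (hac : IsMaxRatioBound a c)
    (hc : 0 ≤ c) {q : ℝ} (hq : 0 ≤ q) (X₁ : Matrix (Fin (n / 2)) (Fin p) ℝ) :
    ∫⁻ X₂, ENNReal.ofReal (q / (c * p)) * ∑ i,
        maxRatio a (nullSet Om i) (recycledStat K P i (joinRows (splitEquiv n) X₁ X₂))
      ∂iidRows (rowLaw Om) (Fin (n - n / 2)) ≤ ENNReal.ofReal q := by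
  have hratio (i) : Measurable fun X₂ => maxRatio a (nullSet Om i)
      (recycledStat K P i (joinRows (splitEquiv n) X₁ X₂)) :=
    measurable_maxRatio _ _ ((measurable_recycledStat hK hnp hs i).comp
      ((measurable_joinRows (splitEquiv n)).comp measurable_prodMk_left))
  rw [lintegral_const_mul _ (Finset.measurable_sum _ fun i _ => hratio i),
    lintegral_finsetSum _ fun i _ => hratio i]
  calc _ ≤ ENNReal.ofReal (q / (c * p)) * ∑ _i : Fin p, ENNReal.ofReal c := by
        gcongr with i
        exact lintegral_maxRatio_recycledStat_le hK hnp hOm hs ha hac X₁ i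
    _ = ENNReal.ofReal (q / (c * p) * (p * c)) := by
        rw [Finset.sum_const, Finset.card_univ, Fintype.card_fin, nsmul_eq_mul,
          ← ENNReal.ofReal_natCast, ← ENNReal.ofReal_mul p.cast_nonneg,
          ← ENNReal.ofReal_mul (by positivity)]
    _ ≤ ENNReal.ofReal q := by
        rw [mul_comm (p : ℝ), div_mul_eq_mul_div, mul_div_assoc]
        exact ENNReal.ofReal_le_ofReal (mul_le_of_le_one_right hq (div_self_le_one _))

end RecycledStat

/-! ### Data-dependent hyperparameters -/

section Choice

variable {α β γ δ : Type*} [MeasurableSpace α] [MeasurableSpace β] [MeasurableSpace δ]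
  {C : Set γ} {s : α → γ}

lemma measurable_of_countable_choice (hC : C.Countable) (hs : ∀ x, s x ∈ C)
    (hsm : ∀ c, MeasurableSet {x | s x = c}) {g : γ → α → δ} (hg : ∀ c ∈ C, Measurable (g c)) :
    Measurable fun x => g (s x) x := by
  intro t ht
  have hpre : (fun x => g (s x) x) ⁻¹' t = ⋃ c ∈ C, {x | s x = c} ∩ g c ⁻¹' t := by
    ext x
    simp only [Set.mem_preimage, Set.mem_iUnion, Set.mem_inter_iff, Set.mem_ofPred_eq, exists_prop]
    exact ⟨fun h => ⟨s x, hs x, rfl, h⟩, by rintro ⟨c, -, rfl, h⟩; exact h⟩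
  rw [hpre]
  exact MeasurableSet.biUnion hC fun c hc => (hsm c).inter (hg c hc ht)

lemma lintegral_choice_le {κ : Measure α} [IsProbabilityMeasure κ] {ρ : Measure β} [SFinite ρ]
    (hC : C.Countable) (hs : ∀ x, s x ∈ C) (hsm : ∀ c, MeasurableSet {x | s x = c})
    {G : γ → α × β → ℝ≥0∞} (hG : ∀ c ∈ C, Measurable (G c)) {r : ℝ≥0∞}
    (hr : ∀ c ∈ C, ∀ x, ∫⁻ y, G c (x, y) ∂ρ ≤ r) : ∫⁻ z, G (s z.1) z ∂κ.prod ρ ≤ r := by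
  have hGs : Measurable fun z : α × β => G (s z.1) z :=
    measurable_of_countable_choice (s := fun z : α × β => s z.1) hC (fun z => hs z.1)
      (fun c => measurable_fst (hsm c)) hG
  rw [lintegral_prod _ hGs.aemeasurable]
  exact lintegral_le_const (ae_of_all _ fun x => hr _ (hs x) x)

end Choice

section RandomSplit

variable {Ω S : Type*} [MeasurableSpace Ω] [MeasurableSpace S] {μ : Measure Ω}
  [IsProbabilityMeasure μ] {n p : ℕ} {Om : Matrix (Fin p) (Fin p) ℝ}
  {X : Ω → Matrix (Fin n) (Fin p) ℝ} {U : Ω → S} {split : S → Equiv.Perm (Fin n)}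

lemma measurePreserving_prodMk_splitData (hX : IsGaussianSample μ Om X) (hU : Measurable U)
    (hUX : IndepFun U X μ) (hsplit : ∀ π, MeasurableSet {u | split u = π}) :
    MeasurePreserving (fun ω => (U ω, splitData split (U ω) (X ω))) μ
      ((μ.map U).prod (iidRows (rowLaw Om) (Fin n))) := by
  have := Measure.isProbabilityMeasure_map (μ := μ) hU.aemeasurable
  have hpair : MeasurePreserving (fun ω => (U ω, X ω)) μ
      ((μ.map U).prod (iidRows (rowLaw Om) (Fin n))) :=
    ⟨hU.prodMk hX.measurable, by
      rw [(indepFun_iff_map_prod_eq_prod_map_map hU.aemeasurable hX.measurable.aemeasurable).1 hUX,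
        hX.map_eq]⟩
  have hmeas : Measurable (Function.uncurry fun u (Y : Matrix (Fin n) (Fin p) ℝ) =>
      splitData split u Y) :=
    measurable_of_countable_choice (s := fun z : S × Matrix (Fin n) (Fin p) ℝ => split z.1)
      (g := fun π z => z.2.submatrix π id) Set.countable_univ (fun _ => Set.mem_univ _)
      (fun π => measurable_fst (hsplit π))
      fun π _ => measurable_of_entries fun k j => (measurable_entry (π k) j).comp measurable_snd
  exact ((MeasurePreserving.id _).skew_product hmeas (ae_of_all _ fun u =>
    (measurePreserving_submatrix (split u).injective).map_eq)).comp hpair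

lemma measurePreserving_prodMk_halves_splitData (hX : IsGaussianSample μ Om X) (hU : Measurable U)
    (hUX : IndepFun U X μ) (hsplit : ∀ π, MeasurableSet {u | split u = π}) :
    MeasurePreserving (fun ω => ((U ω, firstHalf (splitData split (U ω) (X ω))),
        secondHalf (splitData split (U ω) (X ω)))) μ
      (((μ.map U).prod (iidRows (rowLaw Om) (Fin (n / 2)))).prod
        (iidRows (rowLaw Om) (Fin (n - n / 2)))) := by
  have := Measure.isProbabilityMeasure_map (μ := μ) hU.aemeasurable
  exact (measurePreserving_prodAssoc _ _ _).symm.comp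
    (((MeasurePreserving.id _).prod (measurePreserving_halves n)).comp
      (measurePreserving_prodMk_splitData hX hU hUX hsplit))

lemma ae_mulVec_injective_secondHalf_splitData (hnp : 2 * p ≤ n) (hOm : Om.PosDef)
    (hX : IsGaussianSample μ Om X) (hU : Measurable U) (hUX : IndepFun U X μ)
    (hsplit : ∀ π, MeasurableSet {u | split u = π}) :
    ∀ᵐ ω ∂μ, Function.Injective (secondHalf (splitData split (U ω) (X ω))).mulVec := by
  have := Measure.isProbabilityMeasure_map (μ := μ) hU.aemeasurable
  exact (measurePreserving_snd.comp (measurePreserving_prodMk_halves_splitData hX hU hUX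
    hsplit)).quasiMeasurePreserving.ae (ae_mulVec_injective hOm (by omega))

variable {C : Set (Hyper p)} {sel : S → Matrix (Fin (n / 2)) (Fin p) ℝ → Hyper p}

lemma lintegral_chosenHyper_le (hX : IsGaussianSample μ Om X) (hU : Measurable U)
    (hUX : IndepFun U X μ) (hsplit : ∀ π, MeasurableSet {u | split u = π}) (hC : C.Countable)
    (hselm : ∀ h, MeasurableSet {z : S × Matrix (Fin (n / 2)) (Fin p) ℝ | sel z.1 z.2 = h})
    (hsel : ∀ u X₁, sel u X₁ ∈ C) {G : Hyper p → Matrix (Fin n) (Fin p) ℝ → ℝ≥0∞}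
    (hG : ∀ h ∈ C, Measurable (G h)) {r : ℝ≥0∞}
    (hr : ∀ h ∈ C, ∀ X₁, ∫⁻ X₂, G h (joinRows (splitEquiv n) X₁ X₂)
      ∂iidRows (rowLaw Om) (Fin (n - n / 2)) ≤ r) :
    ∫⁻ ω, G (chosenHyper split sel (U ω) (X ω)) (splitData split (U ω) (X ω)) ∂μ ≤ r := by
  have := Measure.isProbabilityMeasure_map (μ := μ) hU.aemeasurable
  let sel' (z : S × Matrix (Fin (n / 2)) (Fin p) ℝ) : Hyper p := sel z.1 z.2
  let G' (h : Hyper p) (z : (S × Matrix (Fin (n / 2)) (Fin p) ℝ) ×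
    Matrix (Fin (n - n / 2)) (Fin p) ℝ) : ℝ≥0∞ := G h (joinRows (splitEquiv n) z.1.2 z.2)
  have hG' (h) (hh : h ∈ C) : Measurable (G' h) :=
    (hG h hh).comp ((measurable_joinRows (splitEquiv n)).comp
      ((measurable_snd.comp measurable_fst).prodMk measurable_snd))
  have hsel' (z) : sel' z ∈ C := hsel z.1 z.2
  calc _ = ∫⁻ ω, G' (sel' (U ω, firstHalf (splitData split (U ω) (X ω))))
          ((U ω, firstHalf (splitData split (U ω) (X ω))),
            secondHalf (splitData split (U ω) (X ω))) ∂μ := by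
        simp only [G', joinRows_firstHalf_secondHalf]
        rfl
    _ = ∫⁻ z, G' (sel' z.1) z ∂_ :=
        (measurePreserving_prodMk_halves_splitData hX hU hUX hsplit).lintegral_comp
          (measurable_of_countable_choice (s := sel' ∘ Prod.fst) hC (fun z => hsel' z.1)
            (fun h => measurable_fst (hselm h)) hG')
    _ ≤ r := lintegral_choice_le hC hsel' hselm hG' fun h hh z => hr h hh z.2

/-- The hyperparameters for which errors are controlled: `(a, c_a)` satisfies the bound on the
expected maximal ratio, the construction yields knockoffs, and the procedure is sufficient and
antisymmetric. -/
structure IsAdmissible (K : OptStrategy → KnockoffRule p) (h : Hyper p) : Prop where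
  fst_pos : 0 < h.ac.1
  snd_pos : 0 < h.ac.2
  isMaxRatioBound : IsMaxRatioBound h.ac.1 h.ac.2
  makesKnockoffs : MakesKnockoffs (K h.opt)
  hasSufficiency : HasSufficiency h.proc
  hasAntisymmetry : HasAntisymmetry h.proc

theorem lintegral_recycling_loss_le (hnp : 4 * p ≤ n) (hOm : Om.PosDef)
    (hX : IsGaussianSample μ Om X) (hU : Measurable U) (hUX : IndepFun U X μ)
    (hsplit : ∀ π, MeasurableSet {u | split u = π}) {K : OptStrategy → KnockoffRule p}
    (hC : C.Countable) (hCK : ∀ h ∈ C, IsAdmissible K h) {q : ℝ} (hq : 0 ≤ q)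
    (hselm : ∀ h, MeasurableSet {z : S × Matrix (Fin (n / 2)) (Fin p) ℝ | sel z.1 z.2 = h})
    (hsel : ∀ u X₁, sel u X₁ ∈ C) {L : Hyper p → Matrix (Fin n) (Fin p) ℝ → ℝ≥0∞}
    (hL : ∀ h ∈ C, ∀ Y, L h Y ≤ ENNReal.ofReal (q / (h.ac.2 * p)) *
      ∑ i, maxRatio h.ac.1 (nullSet Om i) (statMatrix h.proc Y (recycledKnockoff (K h.opt) Y) i)) :
    ∫⁻ ω, L (chosenHyper split sel (U ω) (X ω)) (splitData split (U ω) (X ω)) ∂μ ≤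
      ENNReal.ofReal q := by
  let G (h : Hyper p) (Y : Matrix (Fin n) (Fin p) ℝ) : ℝ≥0∞ :=
    ENNReal.ofReal (q / (h.ac.2 * p)) * ∑ i, maxRatio h.ac.1 (nullSet Om i)
      (recycledStat (K h.opt) h.proc i Y)
  have hG (h) (hh : h ∈ C) : Measurable (G h) :=
    (Finset.measurable_sum _ fun i _ => measurable_maxRatio _ _
      (measurable_recycledStat (hCK h hh).makesKnockoffs hnp
        (hCK h hh).hasSufficiency i)).const_mul _
  have hLG (h) (hh : h ∈ C) (Y) (hY : Function.Injective (secondHalf Y).mulVec) :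
      L h Y ≤ G h Y := by
    simpa only [G, recycledStat_of_injective (nodeDesign_mulVec_injective hY _)] using hL h hh Y
  calc _ ≤ ∫⁻ ω, G (chosenHyper split sel (U ω) (X ω)) (splitData split (U ω) (X ω)) ∂μ :=
        lintegral_mono_ae ((ae_mulVec_injective_secondHalf_splitData (by omega) hOm hX hU hUX
          hsplit).mono fun ω hω => hLG _ (hsel _ _) _ hω)
    _ ≤ ENNReal.ofReal q :=
        lintegral_chosenHyper_le hX hU hUX hsplit hC hselm hsel hG fun h hh =>
          lintegral_sum_maxRatio_recycledStat_le (hCK h hh).makesKnockoffs hnp hOm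
            (hCK h hh).hasSufficiency (hCK h hh).hasAntisymmetry (hCK h hh).isMaxRatioBound
            (hCK h hh).snd_pos.le hq

end RandomSplit

/-! ### False edges -/

section FalseEdges

variable {p : ℕ} {Om : Matrix (Fin p) (Fin p) ℝ}

open Classical in
lemma falseEdges_subset (E : Finset (Fin p × Fin p)) : falseEdges Om E ⊆ E :=
  Finset.filter_subset _ _

lemma mem_nullSet_of_mem_falseEdges_estEdges (hOm : Om.PosDef) {r : EdgeRule}
    {W : Fin p → Fin p → ℝ} {T : Fin p → EReal} :
    ∀ e ∈ falseEdges Om (estEdges r W T), e.2 ∈ nullSet Om e.1 ∧ e.1 ∈ nullSet Om e.2 := by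
  intro e he
  simp only [falseEdges, estEdges, edgesOf, Finset.mem_filter] at he
  obtain ⟨⟨-, hlt, -⟩, hnot⟩ := he
  have hzero := precision_eq_zero_of_not_isEdge hOm hlt.ne hnot
  have hsymm : Om e.2 e.1 = Om e.1 e.2 := by simpa using hOm.isHermitian.apply e.1 e.2
  exact ⟨Finset.mem_filter.2 ⟨Finset.mem_univ _, hlt.ne', hzero⟩,
    Finset.mem_filter.2 ⟨Finset.mem_univ _, hlt.ne, hsymm.trans hzero⟩⟩

end FalseEdges

/-! ### The candidate hyperparameters -/

section Candidates

variable {p : ℕ} {A : Set (ℝ × ℝ)} {Os : Set OptStrategy} {Ps : Set (FeatureProcedure p)}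
  {Rs : Set EdgeRule}

lemma countable_candidates (hA : A.Countable) (hPs : Ps.Countable) :
    (candidates A Os Ps Rs).Countable := by
  have hOs : Os.Countable := (Set.toFinite {.equi, .sdp}).countable.mono fun o _ => by
    cases o <;> simp
  have hRs : Rs.Countable := (Set.toFinite {.AND, .OR}).countable.mono fun r _ => by
    cases r <;> simp
  refine ((hA.prod (hOs.prod (hPs.prod hRs))).image
    fun t => (⟨t.1, t.2.1, t.2.2.1, t.2.2.2⟩ : Hyper p)).mono ?_
  rintro h ⟨hac, hopt, hproc, hrule⟩
  exact ⟨(h.ac, h.opt, h.proc, h.rule), ⟨hac, hopt, hproc, hrule⟩, rfl⟩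

lemma isAdmissible_of_mem_candidates
    (hA : A ⊆ {((1 : ℝ), (1.93 : ℝ)), ((0.01 : ℝ), (102 : ℝ))})
    (hsuff : ∀ P ∈ Ps, HasSufficiency P) (hanti : ∀ P ∈ Ps, HasAntisymmetry P)
    {K : OptStrategy → KnockoffRule p} (hK : ∀ o, MakesKnockoffs (K o)) {h : Hyper p}
    (hh : h ∈ candidates A Os Ps Rs) : IsAdmissible K h := by
  obtain ⟨hac, -, hproc, -⟩ := hh
  have hbound : 0 < h.ac.1 ∧ 0 < h.ac.2 ∧ IsMaxRatioBound h.ac.1 h.ac.2 := by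
    rcases hA hac with hac | hac <;> rw [hac]
    · exact ⟨by norm_num, by norm_num, isMaxRatioBound_one⟩
    · exact ⟨by norm_num, by norm_num, isMaxRatioBound_centi⟩
  exact ⟨hbound.1, hbound.2.1, hbound.2.2, hK h.opt, hsuff _ hproc, hanti _ hproc⟩

end Candidates

end GGMKnockoff

open GGMKnockoff in
theorem theorem3_general
    {Ω : Type*} [MeasurableSpace Ω] (μ : Measure Ω) [IsProbabilityMeasure μ]
    {S : Type*} [MeasurableSpace S] (n p : ℕ) (hnp : 4 * p ≤ n)
    (Om : Matrix (Fin p) (Fin p) ℝ) (hOm : Om.PosDef)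
    (X : Ω → Matrix (Fin n) (Fin p) ℝ) (hX : IsGaussianSample μ Om X)
    (U : Ω → S) (hU : Measurable U) (hUX : IndepFun U X μ)
    (split : S → Equiv.Perm (Fin n)) (hsplit : ∀ π, MeasurableSet {u | split u = π})
    (K : OptStrategy → KnockoffRule p) (C : Set (Hyper p)) (hC : C.Countable)
    (hCK : ∀ h ∈ C, IsAdmissible K h) (q : ℝ) (hq : 0 ≤ q)
    (sel : S → Matrix (Fin (n / 2)) (Fin p) ℝ → Hyper p)
    (hselm : ∀ h, MeasurableSet {z : S × Matrix (Fin (n / 2)) (Fin p) ℝ | sel z.1 z.2 = h})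
    (hsel : ∀ u X₁, sel u X₁ ∈ C) :
    FDR μ Om (fun ω => recyclingProcedure K q 1 split sel (U ω) (X ω)) ≤ ENNReal.ofReal q ∧
    mFDRre μ Om q (fun ω => chosenHyper split sel (U ω) (X ω))
      (fun ω => recyclingProcedure K q 0 split sel (U ω) (X ω)) ≤ ENNReal.ofReal q := by
  have hloss {L} := lintegral_recycling_loss_le (L := L) hnp hOm hX hU hUX hsplit hC hCK hq
    hselm hsel
  constructor
  · exact hloss
      (L := fun h Y => ((falseEdges Om (recycledFilter K q 1 h Y)).card : ℝ≥0∞) /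
        max ((recycledFilter K q 1 h Y).card : ℝ≥0∞) 1)
      fun h hh _ => fdp_le_sum_maxRatio (hCK h hh).fst_pos (hCK h hh).snd_pos hq
        (falseEdges_subset _) (mem_nullSet_of_mem_falseEdges_estEdges hOm)
  · exact hloss
      (L := fun h Y => ((falseEdges Om (recycledFilter K q 0 h Y)).card : ℝ≥0∞) /
        ((recycledFilter K q 0 h Y).card + mFDROffset q h))
      fun h hh _ => mfdp_le_sum_maxRatio (hCK h hh).fst_pos (hCK h hh).snd_pos hq
        (falseEdges_subset _) (mem_nullSet_of_mem_falseEdges_estEdges hOm)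

theorem theorem3
    {Ω : Type*} [MeasurableSpace Ω] (μ : MeasureTheory.Measure Ω)
    [MeasureTheory.IsProbabilityMeasure μ]
    {S : Type*} [MeasurableSpace S]
    (n p : ℕ) (hnp : 4 * p ≤ n)
    (Om : Matrix (Fin p) (Fin p) ℝ) (hOm : Om.PosDef)
    (X : Ω → Matrix (Fin n) (Fin p) ℝ) (hX : GGMKnockoff.IsGaussianSample μ Om X)
    -- auxiliary randomness (splitting, tie-breaking), independent of the data
    (U : Ω → S) (hU : Measurable U) (hUX : ProbabilityTheory.IndepFun U X μ)
    (split : S → Equiv.Perm (Fin n)) (hsplit : ∀ π, MeasurableSet {u | split u = π})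
    -- hyperparameter space
    (A : Set (ℝ × ℝ)) (hA : A ⊆ {((1 : ℝ), (1.93 : ℝ)), ((0.01 : ℝ), (102 : ℝ))})
    (Os : Set GGMKnockoff.OptStrategy) (Rs : Set GGMKnockoff.EdgeRule)
    (Ps : Set (GGMKnockoff.FeatureProcedure p)) (hPs : Ps.Finite)
    (hsuff : ∀ P ∈ Ps, GGMKnockoff.HasSufficiency P)
    (hanti : ∀ P ∈ Ps, GGMKnockoff.HasAntisymmetry P)
    -- knockoff constructions, on raw or on standardized designs
    (std : Bool) (K : GGMKnockoff.OptStrategy → GGMKnockoff.KnockoffRule p)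
    (hK : ∀ o, GGMKnockoff.IsKnockoffRule std o (K o))
    (q : ℝ) (hq : q ∈ Set.Icc (0 : ℝ) 1) :
    (∀ sel : S → Matrix (Fin (n / 2)) (Fin p) ℝ → GGMKnockoff.Hyper p,
      GGMKnockoff.IsSelection (GGMKnockoff.candidates A Os Ps Rs) K q 1 sel →
      GGMKnockoff.FDR μ Om
          (fun ω => GGMKnockoff.recyclingProcedure K q 1 split sel (U ω) (X ω))
        ≤ ENNReal.ofReal q) ∧
    (∀ sel : S → Matrix (Fin (n / 2)) (Fin p) ℝ → GGMKnockoff.Hyper p,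
      GGMKnockoff.IsSelection (GGMKnockoff.candidates A Os Ps Rs) K q 0 sel →
      GGMKnockoff.mFDRre μ Om q
          (fun ω => GGMKnockoff.chosenHyper split sel (U ω) (X ω))
          (fun ω => GGMKnockoff.recyclingProcedure K q 0 split sel (U ω) (X ω))
        ≤ ENNReal.ofReal q) := by
  have hC := GGMKnockoff.countable_candidates (Os := Os) (Rs := Rs)
    (((Set.finite_singleton _).insert _).subset hA).countable hPs.countable
  have hCK := fun h => GGMKnockoff.isAdmissible_of_mem_candidates (Os := Os) (Rs := Rs) (h := h)
    hA hsuff hanti fun o => (hK o).makesKnockoffs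
  have hgeneral := theorem3_general μ n p hnp Om hOm X hX U hU hUX split hsplit K _ hC hCK q hq.1
  exact ⟨fun sel hsel => (hgeneral sel hsel.measurable hsel.mem).1,
    fun sel hsel => (hgeneral sel hsel.measurable hsel.mem).2⟩
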